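/- Let $N\ge 1$, $\sigma>0$, $\alpha=(\alpha_1,\dots,\alpha_N)$ with all $\alpha_i>0$, let $W=\{W_u;\,u\in\mathbb R^N\}$ be a Brownian sheet on $\mathbb R^N$ and $Y_0$ a real random variable independent of $W$, with law $\nu$. Let $Y=\{Y_t;\,t\in\mathbb R_+^N\}$ be the process with, for each $t\in\mathbb R_+^N$, almost surely $$Y_t=e^{-\langle\alpha,t\rangle}\Big[Y_0+\sigma\int_{(-\infty,t]\setminus(-\infty,0]}e^{\langle\alpha,u\rangle}\,dW_u\Big],$$ the integral being the Wiener integral. On $\mathbb R_+^N$ consider $\mathcal A=\{[0,t];\,t\in\mathbb R_+^N\}$ and the measure $m_\alpha(A)=\sum_{i=1}^N\alpha_i\lambda_1(A\cap e_i)$, where $\lambda_1$ is the one-dimensional Lebesgue measure on the $i$-th axis $e_i$. *Definitions.* A pair $(\mathcal A,m)$, with $m$ a Radon measure on a space $\mathcal T$ and $\mathcal A$ a nonempty collection of compact subsets of $\mathcal T$, is an indexing collection if $\emptyset'=\bigcap_{A\in\mathcal A}A$ is nonempty; $\mathcal A$ is closed under (nonempty) intersections; whenever $A\subseteq A_1\cup\dots\cup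 A_k$ in $\mathcal A$, some $A_i$ contains $A$; $m(\emptyset')=0$; and $m(U_n)\to m\big(\overline{\bigcup_kU_k}\big)$ for every increasing sequence $(U_n)$ in $\mathcal A$. Given $\lambda,\tau>0$ and a probability law $\nu$ on $\mathbb R$, a real process $X=\{X_U;\,U\in\mathcal A\}$ is a *set-indexed Ornstein–Uhlenbeck process on $(\mathcal T,\mathcal A,m)$ with parameters $(\lambda,\tau)$ and initial law $\nu$* if $X_{\emptyset'}\sim\nu$ and the following holds for all $A\in\mathcal A$ and all $B=A_1\cup\dots\cup A_k\subseteq A$, where $k\ge1$, $A_i\in\mathcal A$ and $A_i\not\subseteq A_j$ for $i\ne j$. Put $C=A\setminus B$; let $\mathcal G^*_C$ be the $\sigma$-field generated by the $X_U$ with $U\in\mathcal A$ contained in a finite union of elements of $\mathcal A$ that is disjoint from $C$; let $\mathcal A_C$ be the set of all intersections $U$ of nonempty subfamilies of $\{A_1,\dots,A_k\}$ with $U\not\subseteq B^\circ$; let $\mathbf X_C=(X_U)_{U\in\mathcal A_C}$ and $c_U=\sum_{\emptyset\ne S\subseteq\{1,\dots,k\},\ \bigcap_{i\in S}A_i=U}(-1)^{|S|+1}$.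 Then for every Borel $f\ge0$, almost surely, $$E[f(X_A)\mid\mathcal G^*_C]=E[f(X_A)\mid\mathbf X_C]=\int f(y)\,P_C(\mathbf X_C;dy),$$ where $P_C(\mathbf x;\cdot)$ is the normal law (a Dirac mass if the variance is $0$) with $$\text{mean } e^{-\lambda m(A)}\sum_{U\in\mathcal A_C}c_U\,x_U\,e^{\lambda m(U)},\qquad \text{variance } \frac{\tau^2}{2\lambda}\Big(1-e^{-2\lambda m(A)}\sum_{U\in\mathcal A_C}c_U\,e^{2\lambda m(U)}\Big).$$ *Claim.* $(\mathcal A,m_\alpha)$ is an indexing collection, and $X_{[0,t]}:=Y_t$ is a set-indexed Ornstein–Uhlenbeck process on $(\mathbb R_+^N,\mathcal A,m_\alpha)$ with parameters $\lambda=1$ and $\widetilde\sigma=\big(2\sigma^2/\prod_{i=1}^N(2\alpha_i)\big)^{1/2}$ and initial law $\nu$. Moreover, every set-indexed Ornstein–Uhlenbeck process $X$ on $(\mathbb R_+^N,\mathcal A,m_\alpha)$ with these parameters and this initial law, on any probability space, satisfies $\{X_{[0,t]};\,t\in\mathbb R_+^N\}\overset{d}{=}\{Y_t;\,t\in\mathbb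 R_+^N\}$. -/

import Mathlib

open MeasureTheory ProbabilityTheory Filter
open scoped NNReal ENNReal Topology

namespace SetIndexed

/-! ### Indexing collections -/

section Indexing

variable {T : Type*}

/-- `m` is a Radon measure on `T` and `𝒜` an indexing collection of compact sets: the intersection
`∅' = ⋂₀ 𝒜` is nonempty, `𝒜` is closed under arbitrary intersections, the Shape hypothesis holds,
`m(∅') = 0` and `m` is monotonically continuous on `𝒜`. -/
structure IsIndexingCollection [TopologicalSpace T] [MeasurableSpace T]
    (𝒜 : Set (Set T)) (m : Measure T) : Prop where
  radon : m.Regular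
  nonempty : 𝒜.Nonempty
  isCompact : ∀ A ∈ 𝒜, IsCompact A
  sInter_nonempty : (⋂₀ 𝒜).Nonempty
  sInter_mem : ∀ 𝒮 : Set (Set T), 𝒮 ⊆ 𝒜 → 𝒮.Nonempty → ⋂₀ 𝒮 ∈ 𝒜
  shape : ∀ A ∈ 𝒜, ∀ 𝓑 : Finset (Set T), (∀ B ∈ 𝓑, B ∈ 𝒜) → A ⊆ ⋃₀ (𝓑 : Set (Set T)) →
    ∃ B ∈ 𝓑, A ⊆ B
  measure_sInter : m (⋂₀ 𝒜) = 0
  monotone_continuous : ∀ u : ℕ → Set T, (∀ n, u n ∈ 𝒜) → Monotone u →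
    Tendsto (fun n => m (u n)) atTop (𝓝 (m (closure (⋃ n, u n))))

/-- The class `𝒜(u)` of finite (nonempty) unions of elements of `𝒜`. -/
def finiteUnions (𝒜 : Set (Set T)) : Set (Set T) :=
  {B | ∃ 𝓑 : Finset (Set T), 𝓑.Nonempty ∧ (∀ A ∈ 𝓑, A ∈ 𝒜) ∧ B = ⋃₀ (𝓑 : Set (Set T))}

/-- `𝓑 = {A₁, …, A_k}` (with `k ≥ 1`) is the extremal representation of a set
`B = A₁ ∪ … ∪ A_k ∈ 𝒜(u)` with `B ⊆ A`. -/
structure IsExtremalIn (𝒜 : Set (Set T)) (A : Set T) (𝓑 : Finset (Set T)) : Prop where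
  nonempty : 𝓑.Nonempty
  mem : ∀ U ∈ 𝓑, U ∈ 𝒜
  antichain : ∀ U ∈ 𝓑, ∀ V ∈ 𝓑, U ⊆ V → U = V
  subset : ⋃₀ (𝓑 : Set (Set T)) ⊆ A

open Classical in
/-- The semilattice `𝒜_ℓ` of all intersections of the elements of nonempty subfamilies of `𝓑`. -/
noncomputable def semilattice (𝓑 : Finset (Set T)) : Finset (Set T) :=
  (𝓑.powerset.filter (fun S : Finset (Set T) => S.Nonempty)).image
    (fun S : Finset (Set T) => ⋂₀ (S : Set (Set T)))

open Classical in
/-- For `C = A \ B` and `𝓑` the extremal representation of `B`, the collection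
`𝒜_C = {U ∈ 𝒜_ℓ : U ⊄ B°}`. -/
noncomputable def borderSets [TopologicalSpace T] (𝓑 : Finset (Set T)) : Finset (Set T) :=
  (semilattice 𝓑).filter (fun U => ¬ U ⊆ interior (⋃₀ (𝓑 : Set (Set T))))

open Classical in
/-- The coefficient with which the term `X_U` occurs in the inclusion-exclusion formula
`∑ᵢ X_{Aᵢ} - ∑_{i<j} X_{Aᵢ ∩ Aⱼ} + … + (-1)^{k+1} X_{A₁ ∩ … ∩ A_k}`. Several subfamilies may have
the same intersection `U`, and their signs are added up. -/
noncomputable def inclExclCoeff (𝓑 : Finset (Set T)) (U : Set T) : ℝ :=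
  ∑ S ∈ 𝓑.powerset.filter
      (fun S : Finset (Set T) => S.Nonempty ∧ ⋂₀ (S : Set (Set T)) = U),
    (-1 : ℝ) ^ (S.card + 1)

end Indexing

/-! ### Set-indexed processes: filtrations and the Ornstein-Uhlenbeck transition system -/

section Processes

variable {T Ω : Type*}

/-- The natural filtration `ℱ_A` (for `A ∈ 𝒜`) of the process `{X_U ; U ∈ 𝒜}`. A set-indexed
process is written as a function of all sets, and only its values on `𝒜` are ever used. -/
@[reducible] def naturalFiltration (𝒜 : Set (Set T)) (X : Set T → Ω → ℝ) (A : Set T) : MeasurableSpace Ω :=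
  ⨆ U ∈ {U | U ∈ 𝒜 ∧ U ⊆ A}, MeasurableSpace.comap (X U) inferInstance

/-- `ℱ_B = ⋁_{A ∈ 𝒜, A ⊆ B} ℱ_A` for `B ∈ 𝒜(u)`. -/
@[reducible] def unionFiltration (𝒜 : Set (Set T)) (X : Set T → Ω → ℝ) (B : Set T) : MeasurableSpace Ω :=
  ⨆ A ∈ {A | A ∈ 𝒜 ∧ A ⊆ B}, naturalFiltration 𝒜 X A

/-- The strong past `𝒢*_C = ⋁_{B ∈ 𝒜(u), B ∩ C = ∅} ℱ_B` of an increment `C`. -/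
@[reducible] def strongPast (𝒜 : Set (Set T)) (X : Set T → Ω → ℝ) (C : Set T) : MeasurableSpace Ω :=
  ⨆ B ∈ {B | B ∈ finiteUnions 𝒜 ∧ B ∩ C = ∅}, unionFiltration 𝒜 X B

variable [TopologicalSpace T]

/-- The random vector `X_C = (X_U)_{U ∈ 𝒜_C}`. -/
def borderVector (X : Set T → Ω → ℝ) (𝓑 : Finset (Set T)) (ω : Ω) :
    {U // U ∈ borderSets 𝓑} → ℝ :=
  fun U => X U.1 ω

variable [MeasurableSpace T]

/-- The mean of the transition from the vector `x_C` to `A`: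
`e^{-λ m(A)} ∑_{U ∈ 𝒜_C} (±1) x_U e^{λ m(U)}`, with inclusion-exclusion coefficients. -/
noncomputable def transitionMean (m : Measure T) (lam : ℝ) (A : Set T) (𝓑 : Finset (Set T))
    (x : {U // U ∈ borderSets 𝓑} → ℝ) : ℝ :=
  Real.exp (-lam * m.real A) *
    ∑ U ∈ (borderSets 𝓑).attach, inclExclCoeff 𝓑 U.1 * x U * Real.exp (lam * m.real U.1)

/-- The variance `σ_C² = σ²/(2λ) (1 - e^{-2λ m(A)} ∑_{U ∈ 𝒜_C} (±1) e^{2λ m(U)})`. -/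
noncomputable def transitionVariance (m : Measure T) (lam σ : ℝ) (A : Set T)
    (𝓑 : Finset (Set T)) : ℝ :=
  σ ^ 2 / (2 * lam) * (1 - Real.exp (-2 * lam * m.real A) *
    ∑ U ∈ borderSets 𝓑, inclExclCoeff 𝓑 U * Real.exp (2 * lam * m.real U))

/-- The transition probability `P_C(x_C ; dy)`: it has the density
`(σ_C √(2π))⁻¹ exp (-(y - mean)² / (2 σ_C²))` when `σ_C² > 0`, and is the Dirac mass at the mean
when `σ_C² = 0` (for instance when `C = ∅`). -/
noncomputable def transition (m : Measure T) (lam σ : ℝ) (A : Set T) (𝓑 : Finset (Set T))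
    (x : {U // U ∈ borderSets 𝓑} → ℝ) : Measure ℝ :=
  gaussianReal (transitionMean m lam A 𝓑 x) (transitionVariance m lam σ A 𝓑).toNNReal

/-- `X = {X_U ; U ∈ 𝒜}` is a set-indexed Ornstein-Uhlenbeck process on `(T, 𝒜, m)` with parameters
`λ, σ > 0` and initial distribution `ν`: `X_{∅'} ∼ ν`, and `X` is `𝒞`-Markov with the
`𝒞`-transition system `transition`, that is, for every `C = A \ B` with `B ⊆ A`, and every
nonnegative Borel function `f`,
`E[f(X_A) | 𝒢*_C] = E[f(X_A) | X_C] = ∫ f(y) P_C(X_C ; dy)` almost surely. -/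
structure IsSIOU [MeasurableSpace Ω] (P : Measure Ω) (𝒜 : Set (Set T)) (m : Measure T)
    (lam σ : ℝ) (ν : Measure ℝ) (X : Set T → Ω → ℝ) : Prop where
  lam_pos : 0 < lam
  sigma_pos : 0 < σ
  measurable : ∀ U ∈ 𝒜, Measurable (X U)
  initial : P.map (X (⋂₀ 𝒜)) = ν
  cMarkov : ∀ A ∈ 𝒜, ∀ 𝓑 : Finset (Set T), IsExtremalIn 𝒜 A 𝓑 →
    ∀ f : ℝ → ℝ≥0∞, Measurable f →
      condLExp (strongPast 𝒜 X (A \ ⋃₀ (𝓑 : Set (Set T)))) P (fun ω => f (X A ω)) =ᵐ[P]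
        condLExp (MeasurableSpace.comap (borderVector X 𝓑) inferInstance) P (fun ω => f (X A ω))
  cTransition : ∀ A ∈ 𝒜, ∀ 𝓑 : Finset (Set T), IsExtremalIn 𝒜 A 𝓑 →
    ∀ f : ℝ → ℝ≥0∞, Measurable f →
      condLExp (MeasurableSpace.comap (borderVector X 𝓑) inferInstance) P (fun ω => f (X A ω))
        =ᵐ[P] fun ω => ∫⁻ y, f y ∂(transition m lam σ A 𝓑 (borderVector X 𝓑 ω))

end Processes

/-! ### The Brownian sheet on `ℝ^N` and its Wiener integral -/

section Sheet

variable {N : ℕ} {Ω : Type*} [MeasurableSpace Ω]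

/-- `W` is a Brownian sheet indexed by `ℝ^N`: a centred Gaussian process with covariance
`∏ᵢ (|sᵢ| + |tᵢ| - |sᵢ - tᵢ|) / 2` (which is `∏ᵢ min sᵢ tᵢ` on `ℝ₊^N`). -/
structure IsBrownianSheet (P : Measure Ω) (W : (Fin N → ℝ) → Ω → ℝ) : Prop where
  measurable : ∀ t, Measurable (W t)
  gaussian : IsGaussianProcess W P
  mean : ∀ t, ∫ ω, W t ω ∂P = 0
  cov : ∀ s t, covariance (W s) (W t) P = ∏ i, (|s i| + |t i| - |s i - t i|) / 2

/-- The increment of `W` on the box `∏ᵢ (aᵢ, bᵢ]`: the alternating sum of `W` over its vertices. -/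
def boxIncrement (W : (Fin N → ℝ) → Ω → ℝ) (a b : Fin N → ℝ) (ω : Ω) : ℝ :=
  ∑ S : Finset (Fin N), (-1 : ℝ) ^ S.card * W (S.piecewise a b) ω

/-- A step function `∑ⱼ cⱼ 1_{∏ᵢ (aⱼᵢ, bⱼᵢ]}` on `ℝ^N`, given by its coefficients and boxes. -/
structure StepFunction (N : ℕ) where
  n : ℕ
  coeff : Fin n → ℝ
  lower : Fin n → Fin N → ℝ
  upper : Fin n → Fin N → ℝ
  lower_le_upper : ∀ j, lower j ≤ upper j

/-- The function `ℝ^N → ℝ` given by a step function. -/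
noncomputable def StepFunction.eval (φ : StepFunction N) (u : Fin N → ℝ) : ℝ :=
  ∑ j, φ.coeff j *
    (Set.univ.pi fun i => Set.Ioc (φ.lower j i) (φ.upper j i)).indicator (fun _ => (1 : ℝ)) u

/-- The integral `∑ⱼ cⱼ W(∏ᵢ (aⱼᵢ, bⱼᵢ])` of a step function. -/
def StepFunction.integral (φ : StepFunction N) (W : (Fin N → ℝ) → Ω → ℝ) (ω : Ω) : ℝ :=
  ∑ j, φ.coeff j * boxIncrement W (φ.lower j) (φ.upper j) ω

/-- `I` is (a version of) the Wiener integral `∫ f dW` of `f ∈ L²(ℝ^N)`: the limit in `L²(P)` of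
the integrals of step functions that converge to `f` in `L²(ℝ^N)`. -/
def IsWienerIntegral (P : Measure Ω) (W : (Fin N → ℝ) → Ω → ℝ) (f : (Fin N → ℝ) → ℝ)
    (I : Ω → ℝ) : Prop :=
  MemLp f 2 volume ∧ MemLp I 2 P ∧ ∃ φ : ℕ → StepFunction N,
    Tendsto (fun n => eLpNorm (fun u => f u - (φ n).eval u) 2 volume) atTop (𝓝 0) ∧
    Tendsto (fun n => eLpNorm (fun ω => I ω - (φ n).integral W ω) 2 P) atTop (𝓝 0)

open Classical in
/-- The Wiener integral `∫ f dW`, defined up to almost sure equality (and `0` where there is no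
such integral). -/
noncomputable def wienerIntegral (P : Measure Ω) (W : (Fin N → ℝ) → Ω → ℝ)
    (f : (Fin N → ℝ) → ℝ) : Ω → ℝ :=
  if h : ∃ I, IsWienerIntegral P W f I then h.choose else 0

end Sheet

/-! ### The multiparameter setting -/

section Multiparameter

variable {N : ℕ}

/-- The inclusion `ℝ₊^N → ℝ^N`. -/
def toReals (t : Fin N → ℝ≥0) : Fin N → ℝ := fun i => (t i : ℝ)

/-- The collection `𝒜 = {[0, t] ; t ∈ ℝ₊^N}`. -/
def rectangles (N : ℕ) : Set (Set (Fin N → ℝ≥0)) :=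
  Set.range (fun t : Fin N → ℝ≥0 => Set.Icc 0 t)

/-- The measure `m_α = ∑ᵢ αᵢ λ₁(· ∩ eᵢ)` on `ℝ^N`, where `λ₁` is the Lebesgue measure on the `i`-th
axis `eᵢ`. -/
noncomputable def axisMeasure (α : Fin N → ℝ) : Measure (Fin N → ℝ) :=
  ∑ i, ENNReal.ofReal (α i) • (volume : Measure ℝ).map (fun x => Pi.single i x)

/-- The restriction of `m_α` to `ℝ₊^N`. -/
noncomputable def axisMeasureNonneg (α : Fin N → ℝ) : Measure (Fin N → ℝ≥0) :=
  (axisMeasure α).comap toReals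

/-- The integrand `u ↦ 1_{(-∞,t] \ (-∞,0]}(u) e^{⟨α,u⟩}` on `ℝ^N`. -/
noncomputable def ouIntegrand (α : Fin N → ℝ) (t : Fin N → ℝ≥0) : (Fin N → ℝ) → ℝ :=
  (Set.Iic (toReals t) \ Set.Iic 0).indicator (fun u => Real.exp (∑ i, α i * u i))

/-- The process indexed by rectangles with `X_{[0,t]} = Y_t` (the value on other sets is
irrelevant). -/
noncomputable def ofMultiparameter {Ω : Type*} (Y : (Fin N → ℝ≥0) → Ω → ℝ) :
    Set (Fin N → ℝ≥0) → Ω → ℝ :=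
  Function.extend (fun t : Fin N → ℝ≥0 => Set.Icc 0 t) Y 0

end Multiparameter

end SetIndexed

/-! The measure is chosen so that `m_α([0,t]) = ⟨α,t⟩`. Hence `e^{m(A)} X_A` is `Y₀ + σ I_t`, where
`I_t` is the Wiener integral of `ouIntegrand α t`, and by the Itô isometry `Cov(I_s, I_t) = (e^{2⟨α,
s ⊓ t⟩} - 1) / ∏ 2αᵢ` depends on `s ⊓ t` only.

Markov property. For `C = [0,t] \ ⋃ B`, let `D` be `I_t` minus its inclusion-exclusion sum over `B`.
The signs add up to `1` (`sum_subfamilies_sign`), so `Y₀` drops out, and `X_A` minus the transition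
mean equals `e^{-⟨α,t⟩} σ D` (`residual_ae_eq`). If `[0,u]` misses `C`, then `u ⊓ t ≤ b` for some
`[0,b] ∈ B`; toggling the membership of `[0,b]` in a subfamily reverses its sign but not `u ⊓
corner`, so the alternating sum collapses (`sum_subfamilies_inf`) and `Cov(D, I_u) = 0`. The
integrals are jointly Gaussian and `Y₀` is independent of `W`, so `D` is independent of the whole
strong past (`indepFun_increment`). The conditional law of `X_A`, given the strong past or the
border vector alone, is therefore the normal law around the transition mean with the variance of the
residual. The restriction to `𝒜_C` costs nothing, since the omitted intersections have coefficient
`0`.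

Uniqueness. Take a finite inf-closed set of times containing `0` and remove a maximal element `a`.
The remaining set is inf-closed, its values lie in the strong past of the increment at `a`, and it
contains every corner needed for the border vector. So the transition gives the conditional law of
`X_{[0,a]}` as a function of the remaining values, and induction determines the joint law
(`map_maskedPath_eq`). Every finite set of times sits inside such a set. -/

namespace SetIndexed

/-! ### Inclusion-exclusion over families of rectangles -/

section Combinatorics

variable {N : ℕ}

/-- The cancellation behind inclusion-exclusion: if `g` does not see whether `i` belongs to `S`,
then all terms cancel but the one of `{i}`. -/
theorem sum_powerset_nonempty_eq_singleton {ι : Type*} [DecidableEq ι] (B : Finset ι) {i : ι}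
    (hi : i ∈ B) (g : Finset ι → ℝ)
    (hg : ∀ S ⊆ B, S.Nonempty → g (insert i S) = g S) :
    ∑ S ∈ B.powerset.filter (fun S => S.Nonempty), (-1 : ℝ) ^ (S.card + 1) * g S = g {i} := by
  classical
  rw [Finset.sum_filter]
  conv_lhs => rw [← Finset.insert_erase hi]
  -- Each `S ⊆ B \ {i}` is paired with `insert i S`, of opposite sign. Only the pair of `S = ∅`
  -- survives, because the empty family is not counted while `{i}` is.
  rw [Finset.sum_powerset_insert (Finset.notMem_erase i B), ← Finset.sum_add_distrib,
    Finset.sum_eq_single ∅]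
  · simp
  · intro S hS hne
    have hS' := Finset.mem_powerset.1 hS
    have hSB : S ⊆ B := hS'.trans (Finset.erase_subset _ _)
    have hSn : S.Nonempty := Finset.nonempty_iff_ne_empty.2 hne
    have hiS : i ∉ S := fun h => Finset.notMem_erase i B (hS' h)
    rw [if_pos hSn, if_pos (Finset.insert_nonempty _ _), hg S hSB hSn,
      Finset.card_insert_of_notMem hiS]
    ring
  · simp

theorem Icc_zero_injective : Function.Injective (fun t : Fin N → ℝ≥0 => Set.Icc 0 t) := by
  intro s t h
  have h' : Set.Icc 0 s = Set.Icc 0 t := h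
  apply le_antisymm
  · exact (h'.subset ⟨zero_le, le_rfl⟩).2
  · exact (h'.superset ⟨zero_le, le_rfl⟩).2

theorem Icc_zero_inter (s t : Fin N → ℝ≥0) :
    Set.Icc 0 s ∩ Set.Icc 0 t = Set.Icc 0 (s ⊓ t) := by
  rw [Set.Icc_inter_Icc, sup_idem]

theorem Icc_zero_subset_iff {s t : Fin N → ℝ≥0} : Set.Icc 0 s ⊆ Set.Icc 0 t ↔ s ≤ t :=
  ⟨fun h => (h ⟨zero_le, le_rfl⟩).2, fun h => Set.Icc_subset_Icc_right h⟩

/-- Tracking an inf-closed set `G` of corners is what later shows that a border vector uses only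
times in a given finite inf-closed set. -/
theorem exists_mem_sInter_eq_Icc {G : Set (Fin N → ℝ≥0)} (hG : InfClosed G)
    {S : Finset (Set (Fin N → ℝ≥0))} (hS : S.Nonempty)
    (hmem : ∀ U ∈ S, ∃ s ∈ G, U = Set.Icc 0 s) :
    ∃ s ∈ G, ⋂₀ (S : Set (Set (Fin N → ℝ≥0))) = Set.Icc 0 s := by
  classical
  induction hS using Finset.Nonempty.cons_induction with
  | singleton a =>
    obtain ⟨s, hsG, hs⟩ := hmem a (by simp)
    exact ⟨s, hsG, by simpa using hs⟩
  | cons a S ha hS ih =>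
    obtain ⟨s, hsG, hs⟩ := hmem a (by simp)
    obtain ⟨t, htG, ht⟩ := ih fun U hU => hmem U (by simp [hU])
    refine ⟨s ⊓ t, hG hsG htG, ?_⟩
    rw [Finset.coe_cons, Set.sInter_insert, ht, hs, Icc_zero_inter]

theorem exists_sInter_eq_Icc {S : Finset (Set (Fin N → ℝ≥0))} (hS : S.Nonempty)
    (hmem : ∀ U ∈ S, U ∈ rectangles N) :
    ∃ s, ⋂₀ (S : Set (Set (Fin N → ℝ≥0))) = Set.Icc 0 s := by
  obtain ⟨s, -, hs⟩ := exists_mem_sInter_eq_Icc (G := Set.univ) infClosed_univ hS fun U hU => by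
    obtain ⟨t, rfl⟩ := hmem U hU
    exact ⟨t, trivial, rfl⟩
  exact ⟨s, hs⟩

/-- A rectangle `[0,u]` inside the interior of a union of rectangles has its corner strictly
below, in every coordinate, the corner of one of them. -/
theorem exists_forall_lt_of_Icc_subset_interior {B : Finset (Set (Fin N → ℝ≥0))}
    (hB : ∀ U ∈ B, U ∈ rectangles N) {u : Fin N → ℝ≥0}
    (hu : Set.Icc 0 u ⊆ interior (⋃₀ (B : Set (Set (Fin N → ℝ≥0))))) :
    ∃ t, Set.Icc 0 t ∈ B ∧ ∀ j, u j < t j := by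
  have hmem : u ∈ interior (⋃₀ (B : Set (Set (Fin N → ℝ≥0)))) := hu ⟨zero_le, le_rfl⟩
  have hcont : Tendsto (fun (e : ℝ≥0) (j : Fin N) => u j + e) (𝓝[>] 0) (𝓝 u) := by
    have : Continuous (fun (e : ℝ≥0) (j : Fin N) => u j + e) := by fun_prop
    simpa using (this.tendsto 0).mono_left nhdsWithin_le_nhds
  have hev := hcont.eventually (mem_interior_iff_mem_nhds.1 hmem)
  obtain ⟨e, he, hpos⟩ := (hev.and self_mem_nhdsWithin).exists
  obtain ⟨V, hV, heV⟩ := he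
  obtain ⟨t, rfl⟩ := hB V hV
  exact ⟨t, hV, fun j => lt_of_lt_of_le (lt_add_of_pos_right _ hpos) (heV.2 j)⟩

/-- If `u` is strictly below `t` in every coordinate, intersecting with `[0,t]` cannot affect
whether the result is `[0,u]`. The terms then cancel in pairs, and the survivor `{[0,t]}`
contributes nothing since `t ≠ u`. This is why passing from the semilattice to `𝒜_C` changes no sum.
-/
theorem inclExclCoeff_eq_zero_of_subset_interior (hN : 1 ≤ N) {B : Finset (Set (Fin N → ℝ≥0))}
    (hB : ∀ U ∈ B, U ∈ rectangles N) {U : Set (Fin N → ℝ≥0)} (hU : U ∈ semilattice B)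
    (hUi : U ⊆ interior (⋃₀ (B : Set (Set (Fin N → ℝ≥0))))) : inclExclCoeff B U = 0 := by
  classical
  obtain ⟨S₀, hS₀, rfl⟩ := Finset.mem_image.1 hU
  obtain ⟨hS₀B, hS₀n⟩ := Finset.mem_filter.1 hS₀
  obtain ⟨u, hu⟩ := exists_sInter_eq_Icc hS₀n
    fun U hU => hB U (Finset.mem_powerset.1 hS₀B hU)
  rw [hu] at hUi ⊢
  obtain ⟨t, htB, hut⟩ := exists_forall_lt_of_Icc_subset_interior hB hUi
  have key := sum_powerset_nonempty_eq_singleton B htB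
    (fun S => if ⋂₀ (S : Set (Set (Fin N → ℝ≥0))) = Set.Icc 0 u then (1 : ℝ) else 0) (by
      intro S hSB hS
      obtain ⟨s, hs⟩ := exists_sInter_eq_Icc hS fun U hU => hB U (hSB hU)
      have : ⋂₀ ((insert (Set.Icc 0 t) S : Finset _) : Set (Set (Fin N → ℝ≥0)))
          = Set.Icc 0 (t ⊓ s) := by
        rw [Finset.coe_insert, Set.sInter_insert, hs, Icc_zero_inter]
      have hiff : t ⊓ s = u ↔ s = u := by
        constructor
        · intro h
          funext j
          have hj : min (t j) (s j) = u j := congrFun h j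
          rcases min_choice (t j) (s j) with h' | h'
          · exact absurd (h'.symm.trans hj) (hut j).ne'
          · exact h'.symm.trans hj
        · rintro rfl
          exact inf_eq_right.2 fun j => (hut j).le
      simp only [this, hs, Icc_zero_injective.eq_iff, hiff])
  -- With no coordinates the strict comparison would be vacuous; this is where `1 ≤ N` enters.
  have hne : t ≠ u := fun h => (hut ⟨0, hN⟩).ne' (congrFun h _)
  rw [inclExclCoeff]
  simp only [Finset.coe_singleton, Set.sInter_singleton, Icc_zero_injective.eq_iff, hne,
    if_false, mul_ite, mul_one, mul_zero] at key
  rw [← Finset.sum_filter, Finset.filter_filter] at key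
  exact key

/-- Sums over `𝒜_C` with the inclusion-exclusion coefficients are alternating sums over the
nonempty subfamilies. -/
theorem sum_borderSets (hN : 1 ≤ N) {B : Finset (Set (Fin N → ℝ≥0))}
    (hB : ∀ U ∈ B, U ∈ rectangles N) (h : Set (Fin N → ℝ≥0) → ℝ) :
    ∑ U ∈ borderSets B, inclExclCoeff B U * h U =
      ∑ S ∈ B.powerset.filter (fun S => S.Nonempty),
        (-1 : ℝ) ^ (S.card + 1) * h (⋂₀ (S : Set (Set (Fin N → ℝ≥0)))) := by
  classical
  have h1 : ∑ U ∈ borderSets B, inclExclCoeff B U * h U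
      = ∑ U ∈ semilattice B, inclExclCoeff B U * h U := by
    refine Finset.sum_subset (Finset.filter_subset _ _) fun U hU hU' => ?_
    rw [inclExclCoeff_eq_zero_of_subset_interior hN hB hU, zero_mul]
    by_contra hcon
    exact hU' (Finset.mem_filter.2 ⟨hU, hcon⟩)
  rw [h1, ← Finset.sum_fiberwise_of_maps_to (t := semilattice B)
    (g := fun S : Finset (Set (Fin N → ℝ≥0)) => ⋂₀ (S : Set (Set (Fin N → ℝ≥0))))
    (fun S hS => Finset.mem_image_of_mem _ hS)]
  refine Finset.sum_congr rfl fun U _ => ?_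
  rw [inclExclCoeff, Finset.sum_mul, ← Finset.filter_filter]
  refine Finset.sum_congr rfl fun S hS => ?_
  rw [(Finset.mem_filter.1 hS).2]

end Combinatorics

/-! ### The rectangles with the axis measure form an indexing collection -/

section Indexing

variable {N : ℕ}

theorem measurableEmbedding_toReals : MeasurableEmbedding (toReals (N := N)) := by
  have h : Topology.IsClosedEmbedding (toReals (N := N)) := by
    have hc : Topology.IsClosedEmbedding ((↑) : ℝ≥0 → ℝ) := NNReal.isClosedEmbedding_coe
    refine Topology.IsClosedEmbedding.piMap fun _ => hc
  exact h.measurableEmbedding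

theorem image_toReals_Icc (t : Fin N → ℝ≥0) :
    toReals '' Set.Icc 0 t = Set.Icc 0 (toReals t) := by
  ext x
  constructor
  · rintro ⟨s, hs, rfl⟩
    exact ⟨fun i => (s i).2, fun i => NNReal.coe_le_coe.2 (hs.2 i)⟩
  · intro hx
    exact ⟨fun i => ⟨x i, hx.1 i⟩, ⟨fun i => zero_le, fun i => hx.2 i⟩, rfl⟩

theorem axisMeasureNonneg_Icc (α : Fin N → ℝ) (t : Fin N → ℝ≥0) :
    axisMeasureNonneg α (Set.Icc 0 t) = ∑ i, ENNReal.ofReal (α i) * t i := by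
  rw [axisMeasureNonneg, measurableEmbedding_toReals.comap_apply, image_toReals_Icc, axisMeasure,
    Measure.finsetSum_apply]
  refine Finset.sum_congr rfl fun i _ => ?_
  rw [Measure.smul_apply, Measure.map_apply (measurable_pi_lambda _ fun j => ?_) measurableSet_Icc,
    smul_eq_mul]
  · have : (fun x : ℝ => (Pi.single i x : Fin N → ℝ)) ⁻¹' Set.Icc 0 (toReals t)
        = Set.Icc 0 (t i : ℝ) := by
      ext x
      simp only [Set.mem_preimage, Set.mem_Icc, Pi.single_nonneg]
      refine and_congr_right fun hx => ⟨fun h => by simpa [toReals] using h i, fun h j => ?_⟩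
      rcases eq_or_ne j i with rfl | hj
      · simpa [toReals] using h
      · simp [hj, toReals]
    rw [this, Real.volume_Icc, sub_zero, ENNReal.ofReal_coe_nnreal]
  · rcases eq_or_ne j i with rfl | hj
    · simpa using measurable_id'
    · simp [hj]

theorem axisMeasureNonneg_Icc_lt_top (α : Fin N → ℝ) (t : Fin N → ℝ≥0) :
    axisMeasureNonneg α (Set.Icc 0 t) < ∞ := by
  rw [axisMeasureNonneg_Icc]
  exact ENNReal.sum_lt_top.2 fun i _ => ENNReal.mul_lt_top ENNReal.ofReal_lt_top ENNReal.coe_lt_top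

theorem axisMeasureNonneg_real_Icc {α : Fin N → ℝ} (hα : ∀ i, 0 < α i) (t : Fin N → ℝ≥0) :
    (axisMeasureNonneg α).real (Set.Icc 0 t) = ∑ i, α i * t i := by
  rw [Measure.real, axisMeasureNonneg_Icc, ENNReal.toReal_sum fun i _ =>
    (ENNReal.mul_lt_top ENNReal.ofReal_lt_top ENNReal.coe_lt_top).ne]
  refine Finset.sum_congr rfl fun i _ => ?_
  rw [ENNReal.toReal_mul, ENNReal.toReal_ofReal (hα i).le, ENNReal.coe_toReal]

theorem sInter_rectangles : ⋂₀ rectangles N = Set.Icc 0 0 := by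
  apply le_antisymm
  · exact Set.sInter_subset_of_mem ⟨0, rfl⟩
  · rintro x hx U ⟨t, rfl⟩
    exact ⟨zero_le, hx.2.trans zero_le⟩

instance isLocallyFiniteMeasure_axisMeasureNonneg (α : Fin N → ℝ) :
    IsLocallyFiniteMeasure (axisMeasureNonneg α) := by
  refine ⟨fun x => ⟨Set.Icc 0 (x + 1), ?_, axisMeasureNonneg_Icc_lt_top α _⟩⟩
  have : Set.Icc 0 (x + 1) = Set.univ.pi fun i => Set.Iic (x i + 1) := by
    ext y
    simp [Pi.le_def]
  rw [this]
  exact set_pi_mem_nhds Set.finite_univ fun i _ => Iic_mem_nhds (by simp)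

theorem isIndexingCollection_rectangles {α : Fin N → ℝ} (hα : ∀ i, 0 < α i) :
    IsIndexingCollection (rectangles N) (axisMeasureNonneg α) where
  radon := inferInstance
  nonempty := ⟨_, 0, rfl⟩
  isCompact := by
    rintro _ ⟨t, rfl⟩
    exact isCompact_Icc
  sInter_nonempty := by
    rw [sInter_rectangles]
    exact ⟨0, le_rfl, le_rfl⟩
  sInter_mem := by
    intro 𝒮 h𝒮 hne
    let T : Set (Fin N → ℝ≥0) := {t | Set.Icc 0 t ∈ 𝒮}
    have hT : T.Nonempty := by
      obtain ⟨U, hU⟩ := hne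
      obtain ⟨t, rfl⟩ := h𝒮 hU
      exact ⟨t, hU⟩
    refine ⟨fun i => ⨅ t : T, t.1 i, ?_⟩
    have : Nonempty T := hT.to_subtype
    ext x
    simp only [Set.mem_Icc, Set.mem_sInter, zero_le, true_and]
    constructor
    · intro hx U hU
      obtain ⟨t, rfl⟩ := h𝒮 hU
      exact ⟨zero_le, fun i => (hx i).trans (ciInf_le (OrderBot.bddBelow _) (⟨t, hU⟩ : T))⟩
    · intro hx i
      exact le_ciInf fun t => (hx _ t.2).2 i
  shape := by
    rintro _ ⟨t, rfl⟩ 𝓑 h𝓑 hsub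
    obtain ⟨B, hB, htB⟩ := hsub ⟨zero_le, le_rfl⟩
    obtain ⟨s, rfl⟩ := h𝓑 B hB
    exact ⟨_, hB, Icc_zero_subset_iff.2 htB.2⟩
  measure_sInter := by
    rw [sInter_rectangles, axisMeasureNonneg_Icc]
    simp
  monotone_continuous := by
    intro u hu hmono
    set m := axisMeasureNonneg α with hm
    choose t ht using hu
    have htm : Monotone t := fun a b hab => by
      have := hmono hab
      rw [← ht, ← ht] at this
      exact Icc_zero_subset_iff.1 this
    have hlim : Tendsto (fun n => m (u n)) atTop (𝓝 (m (⋃ n, u n))) :=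
      tendsto_measure_iUnion_atTop hmono
    suffices h : m (closure (⋃ n, u n)) = m (⋃ n, u n) by rwa [h]
    refine le_antisymm ?_ (measure_mono subset_closure)
    by_cases htop : m (⋃ n, u n) = ∞
    · rw [htop]; exact le_top
    -- When the union has finite mass, `αᵢ > 0` bounds every coordinate of the corners. Their
    -- supremum `s` then exists, the closure lies in `[0,s]`, and the explicit formula for the
    -- measure shows that `[0,s]` has no more mass than the union.
    have hle : ∀ n i, ENNReal.ofReal (α i) * t n i ≤ m (⋃ n, u n) := by
      intro n i
      calc ENNReal.ofReal (α i) * t n i ≤ m (u n) := by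
            rw [← ht n, hm, axisMeasureNonneg_Icc]
            exact Finset.single_le_sum (f := fun i => ENNReal.ofReal (α i) * t n i)
              (fun _ _ => zero_le) (Finset.mem_univ i)
        _ ≤ _ := measure_mono (Set.subset_iUnion u n)
    have hbdd : ∀ i, BddAbove (Set.range fun n => t n i) := by
      intro i
      refine ⟨(m (⋃ n, u n) / ENNReal.ofReal (α i)).toNNReal, ?_⟩
      rintro _ ⟨n, rfl⟩
      have hne0 : ENNReal.ofReal (α i) ≠ 0 := by simpa using hα i
      apply ENNReal.le_toNNReal_of_coe_le
      · rw [ENNReal.le_div_iff_mul_le (Or.inl hne0) (Or.inl ENNReal.ofReal_ne_top), mul_comm]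
        exact hle n i
      · exact ENNReal.div_ne_top htop hne0
    let s : Fin N → ℝ≥0 := fun i => ⨆ n, t n i
    have hclos : closure (⋃ n, u n) ⊆ Set.Icc 0 s := by
      refine closure_minimal (Set.iUnion_subset fun n => ?_) isClosed_Icc
      rw [← ht n]
      exact Icc_zero_subset_iff.2 fun i => le_ciSup (hbdd i) n
    refine (measure_mono hclos).trans (le_of_eq ?_)
    have hts : Tendsto (fun n => m (u n)) atTop (𝓝 (m (Set.Icc 0 s))) := by
      simp_rw [← ht, hm, axisMeasureNonneg_Icc]
      refine tendsto_finsetSum _ fun i _ => ENNReal.Tendsto.const_mul ?_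
        (Or.inr ENNReal.ofReal_ne_top)
      exact ENNReal.tendsto_coe.2 (tendsto_atTop_ciSup (fun a b hab => htm hab i) (hbdd i))
    exact tendsto_nhds_unique hts hlim

end Indexing

/-! ### Continuity of the second moment in `L²` -/

section L2

variable {E : Type*} [MeasurableSpace E] {μ : Measure E}

theorem eLpNorm_two_eq_ofReal_sqrt {f : E → ℝ} (hf : MemLp f 2 μ) :
    eLpNorm f 2 μ = ENNReal.ofReal (√(∫ x, f x ^ 2 ∂μ)) := by
  rw [hf.eLpNorm_eq_integral_rpow_norm two_ne_zero ENNReal.ofNat_ne_top, Real.sqrt_eq_rpow]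
  norm_num

theorem tendsto_integral_sq_of_tendsto_eLpNorm_sub {f : E → ℝ} {g : ℕ → E → ℝ}
    (hf : MemLp f 2 μ) (hg : ∀ n, MemLp (g n) 2 μ)
    (h : Tendsto (fun n => eLpNorm (fun x => f x - g n x) 2 μ) atTop (𝓝 0)) :
    Tendsto (fun n => ∫ x, g n x ^ 2 ∂μ) atTop (𝓝 (∫ x, f x ^ 2 ∂μ)) := by
  have h1 : Tendsto (fun n => (hg n).toLp) atTop (𝓝 hf.toLp) := by
    rw [Lp.tendsto_Lp_iff_tendsto_eLpNorm'']
    refine h.congr fun n => ?_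
    rw [← Pi.sub_def, eLpNorm_sub_comm]
  have h2 := (h1.norm).pow 2
  have key : ∀ {k : E → ℝ} (hk : MemLp k 2 μ), ‖hk.toLp‖ ^ 2 = ∫ x, k x ^ 2 ∂μ := by
    intro k hk
    rw [Lp.norm_toLp, eLpNorm_two_eq_ofReal_sqrt hk, ENNReal.toReal_ofReal (Real.sqrt_nonneg _),
      Real.sq_sqrt (integral_nonneg fun x => sq_nonneg _)]
  simpa only [key] using h2

end L2

/-! ### Density of step functions in `L²(ℝ^N)` -/

section StepFunctions

variable {N : ℕ}

theorem memLp_box_indicator (a b : Fin N → ℝ) :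
    MemLp ((Set.univ.pi fun i => Set.Ioc (a i) (b i)).indicator fun _ => (1 : ℝ)) 2 volume :=
  memLp_indicator_const 2 (MeasurableSet.univ_pi fun _ => measurableSet_Ioc) 1
    (Or.inr (by rw [Real.volume_pi_Ioc]; exact (ENNReal.prod_lt_top fun _ _ =>
      ENNReal.ofReal_lt_top).ne))

theorem StepFunction.memLp_eval (φ : StepFunction N) : MemLp φ.eval 2 volume :=
  memLp_finsetSum _ fun j _ => (memLp_box_indicator (φ.lower j) (φ.upper j)).const_mul _

/-- The sum of two step functions. -/
def StepFunction.add (φ ψ : StepFunction N) : StepFunction N where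
  n := φ.n + ψ.n
  coeff := Fin.append φ.coeff ψ.coeff
  lower := Fin.append φ.lower ψ.lower
  upper := Fin.append φ.upper ψ.upper
  lower_le_upper := Fin.addCases (fun j => by simpa using φ.lower_le_upper j)
    fun j => by simpa using ψ.lower_le_upper j

/-- A multiple of a step function. -/
def StepFunction.smul (c : ℝ) (φ : StepFunction N) : StepFunction N where
  n := φ.n
  coeff := fun j => c * φ.coeff j
  lower := φ.lower
  upper := φ.upper
  lower_le_upper := φ.lower_le_upper

theorem StepFunction.eval_add (φ ψ : StepFunction N) (u : Fin N → ℝ) :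
    (φ.add ψ).eval u = φ.eval u + ψ.eval u := by
  refine (Fin.sum_univ_add fun j : Fin (φ.n + ψ.n) => Fin.append φ.coeff ψ.coeff j *
    (Set.univ.pi fun i => Set.Ioc (Fin.append φ.lower ψ.lower j i)
      (Fin.append φ.upper ψ.upper j i)).indicator (fun _ => (1 : ℝ)) u).trans ?_
  simp [StepFunction.eval]

theorem StepFunction.eval_smul (c : ℝ) (φ : StepFunction N) (u : Fin N → ℝ) :
    (φ.smul c).eval u = c * φ.eval u := by
  simp only [StepFunction.eval, StepFunction.smul, Finset.mul_sum, mul_assoc]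
  rfl

theorem StepFunction.integral_add {Ω : Type*} (W : (Fin N → ℝ) → Ω → ℝ)
    (φ ψ : StepFunction N) (ω : Ω) :
    (φ.add ψ).integral W ω = φ.integral W ω + ψ.integral W ω := by
  refine (Fin.sum_univ_add fun j : Fin (φ.n + ψ.n) => Fin.append φ.coeff ψ.coeff j *
    boxIncrement W (Fin.append φ.lower ψ.lower j) (Fin.append φ.upper ψ.upper j) ω).trans ?_
  simp [StepFunction.integral]

theorem StepFunction.integral_smul {Ω : Type*} (W : (Fin N → ℝ) → Ω → ℝ) (c : ℝ)
    (φ : StepFunction N) (ω : Ω) : (φ.smul c).integral W ω = c * φ.integral W ω := by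
  simp only [StepFunction.integral, StepFunction.smul, Finset.mul_sum, mul_assoc]
  rfl

/-- The indicator of a box as a step function. -/
def StepFunction.box (a b : Fin N → ℝ) (hab : a ≤ b) : StepFunction N where
  n := 1
  coeff := fun _ => 1
  lower := fun _ => a
  upper := fun _ => b
  lower_le_upper := fun _ => hab

theorem StepFunction.eval_box (a b : Fin N → ℝ) (hab : a ≤ b) :
    (StepFunction.box a b hab).eval =
      (Set.univ.pi fun i => Set.Ioc (a i) (b i)).indicator fun _ => (1 : ℝ) := by
  funext u
  exact (Fin.sum_univ_one _).trans (one_mul _)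

/-- An `L²` function with vanishing integral over all boxes is zero. -/
theorem ae_eq_zero_of_setIntegral_box_eq_zero {g : (Fin N → ℝ) → ℝ} (hg : MemLp g 2 volume)
    (h : ∀ a b : Fin N → ℝ, a ≤ b →
      ∫ u in Set.univ.pi fun i => Set.Ioc (a i) (b i), g u = 0) : g =ᵐ[volume] 0 := by
  have hloc : LocallyIntegrable g volume := hg.locallyIntegrable one_le_two
  -- Lebesgue differentiation: balls of the sup norm are cubes, equal to half-open boxes up to a
  -- null set, so all averages vanish and so does their limit.
  filter_upwards [IsUnifLocDoublingMeasure.ae_tendsto_average volume hloc 1] with x hx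
  have hδ : Tendsto (fun n : ℕ => 1 / ((n : ℝ) + 1)) atTop (𝓝[>] 0) :=
    tendsto_nhdsWithin_iff.2 ⟨tendsto_one_div_add_atTop_nhds_zero_nat,
      Eventually.of_forall fun n => by
        show (0 : ℝ) < 1 / ((n : ℝ) + 1)
        positivity⟩
  have hlim := hx (fun _ : ℕ => x) _ hδ (Eventually.of_forall fun n =>
    Metric.mem_closedBall_self (by positivity))
  refine tendsto_nhds_unique hlim (tendsto_const_nhds.congr fun n => ?_)
  have hpos : (0 : ℝ) ≤ 1 / ((n : ℝ) + 1) := by positivity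
  rw [setAverage_eq, closedBall_pi _ hpos]
  simp_rw [Real.closedBall_eq_Icc]
  have hae := Measure.univ_pi_Ioc_ae_eq_Icc (μ := fun _ : Fin N => (volume : Measure ℝ))
    (f := fun i => x i - 1 / ((n : ℝ) + 1)) (g := fun i => x i + 1 / ((n : ℝ) + 1))
  rw [← volume_pi] at hae
  rw [Set.pi_univ_Icc, ← setIntegral_congr_set hae]
  rw [h (fun i => x i - 1 / ((n : ℝ) + 1)) (fun i => x i + 1 / ((n : ℝ) + 1))
    (fun i => by simp only; linarith), smul_zero]
  rfl

/-- The class in `L²(ℝ^N)` of a step function. -/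
noncomputable def StepFunction.toLp (φ : StepFunction N) : Lp ℝ 2 (volume : Measure (Fin N → ℝ)) :=
  φ.memLp_eval.toLp φ.eval

theorem StepFunction.toLp_add (φ ψ : StepFunction N) : (φ.add ψ).toLp = φ.toLp + ψ.toLp :=
  (MemLp.toLp_congr _ (φ.memLp_eval.add ψ.memLp_eval) (Eventually.of_forall fun u =>
    φ.eval_add ψ u)).trans (MemLp.toLp_add _ _)

theorem StepFunction.toLp_smul (c : ℝ) (φ : StepFunction N) : (φ.smul c).toLp = c • φ.toLp :=
  (MemLp.toLp_congr _ (φ.memLp_eval.const_smul c) (Eventually.of_forall fun u =>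
    φ.eval_smul c u)).trans (MemLp.toLp_const_smul _ _)

/-- Step functions are dense in `L²(ℝ^N)`. -/
theorem exists_stepFunction_tendsto {f : (Fin N → ℝ) → ℝ} (hf : MemLp f 2 volume) :
    ∃ φ : ℕ → StepFunction N,
      Tendsto (fun n => eLpNorm (fun u => f u - (φ n).eval u) 2 volume) atTop (𝓝 0) := by
  let K : Submodule ℝ (Lp ℝ 2 (volume : Measure (Fin N → ℝ))) :=
    { carrier := Set.range StepFunction.toLp
      zero_mem' := ⟨(StepFunction.box 0 0 le_rfl).smul 0,
        (StepFunction.toLp_smul _ _).trans (zero_smul _ _)⟩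
      add_mem' := by
        rintro _ _ ⟨φ, rfl⟩ ⟨ψ, rfl⟩
        exact ⟨φ.add ψ, φ.toLp_add ψ⟩
      smul_mem' := by
        rintro c _ ⟨φ, rfl⟩
        exact ⟨φ.smul c, φ.toLp_smul c⟩ }
  -- In a Hilbert space, density amounts to a trivial orthogonal complement, and orthogonality to
  -- box indicators means vanishing box integrals.
  have hK : K.topologicalClosure = ⊤ := by
    rw [Submodule.topologicalClosure_eq_top_iff, Submodule.eq_bot_iff]
    intro g hg
    rw [Lp.eq_zero_iff_ae_eq_zero]
    refine ae_eq_zero_of_setIntegral_box_eq_zero (Lp.memLp g) fun a b hab => ?_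
    have hfin : volume (Set.univ.pi fun i => Set.Ioc (a i) (b i)) ≠ ∞ := by
      rw [Real.volume_pi_Ioc]
      exact (ENNReal.prod_lt_top fun _ _ => ENNReal.ofReal_lt_top).ne
    have hmeas : MeasurableSet (Set.univ.pi fun i => Set.Ioc (a i) (b i)) :=
      MeasurableSet.univ_pi fun _ => measurableSet_Ioc
    rw [← L2.inner_indicatorConstLp_one (𝕜 := ℝ) hmeas hfin g]
    refine hg _ ⟨StepFunction.box a b hab, ?_⟩
    exact MemLp.toLp_congr _ _ (by rw [StepFunction.eval_box])
  have hmem : hf.toLp f ∈ closure (K : Set (Lp ℝ 2 (volume : Measure (Fin N → ℝ)))) := by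
    rw [← Submodule.topologicalClosure_coe, hK]
    trivial
  obtain ⟨x, hxK, hx⟩ := mem_closure_iff_seq_limit.1 hmem
  choose φ hφ using hxK
  refine ⟨φ, ?_⟩
  have : Tendsto (fun n => (φ n).memLp_eval.toLp (φ n).eval) atTop (𝓝 (hf.toLp f)) := by
    refine hx.congr fun n => (hφ n).symm
  rw [Lp.tendsto_Lp_iff_tendsto_eLpNorm''] at this
  refine this.congr fun n => ?_
  rw [eLpNorm_sub_comm, Pi.sub_def]

end StepFunctions

/-! ### The isometry for step functions -/

section Isometry

variable {N : ℕ} {Ω : Type*} [MeasurableSpace Ω] {P : Measure Ω} {W : (Fin N → ℝ) → Ω → ℝ}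

/-- Expanding the product over coordinates picks `c` on `T`, with sign `-1` each, and `d` elsewhere.
Thus a product covariance factorizes over the coordinates of box increments. -/
theorem sum_neg_one_pow_mul_prod_piecewise (h : Fin N → ℝ → ℝ) (c d : Fin N → ℝ) :
    ∑ T : Finset (Fin N), (-1 : ℝ) ^ T.card * ∏ i, h i (T.piecewise c d i) =
      ∏ i, (h i (d i) - h i (c i)) := by
  have : ∀ i, h i (d i) - h i (c i) = -h i (c i) + h i (d i) := fun i => by ring
  simp_rw [this, Fintype.prod_add]
  refine Finset.sum_congr rfl fun T _ => ?_
  have h1 : ∀ i, h i (T.piecewise c d i)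
      = T.piecewise (fun i => h i (c i)) (fun i => h i (d i)) i := fun i => by
    by_cases hi : i ∈ T <;> simp [hi]
  simp_rw [h1]
  rw [Finset.prod_piecewise, Finset.univ_inter, Finset.prod_neg, mul_assoc,
    Finset.compl_eq_univ_sdiff]

/-- This is the one-dimensional factor: the second difference of the two-sided Brownian covariance
is the length of `(a,b] ∩ (c,d]`. -/
theorem abs_combination_eq_max {a b c d : ℝ} (hab : a ≤ b) (hcd : c ≤ d) :
    ((|b| + |d| - |b - d|) / 2 - (|b| + |c| - |b - c|) / 2) -
      ((|a| + |d| - |a - d|) / 2 - (|a| + |c| - |a - c|) / 2) = max (min b d - max a c) 0 := by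
  rcases abs_cases (b - d) with h1 | h1 <;> rcases abs_cases (b - c) with h2 | h2 <;>
  rcases abs_cases (a - d) with h3 | h3 <;> rcases abs_cases (a - c) with h4 | h4 <;>
  rcases max_cases (min b d - max a c) 0 with h5 | h5 <;>
  rcases min_cases b d with h6 | h6 <;> rcases max_cases a c with h7 | h7 <;> linarith

theorem IsBrownianSheet.memLp (hW : IsBrownianSheet P W) (t : Fin N → ℝ) : MemLp (W t) 2 P :=
  (hW.gaussian.hasGaussianLaw_eval t).memLp_two

theorem IsBrownianSheet.memLp_boxIncrement (hW : IsBrownianSheet P W) (a b : Fin N → ℝ) :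
    MemLp (boxIncrement W a b) 2 P :=
  memLp_finsetSum _ fun _ _ => (hW.memLp _).const_mul _

theorem IsBrownianSheet.memLp_integral (hW : IsBrownianSheet P W) (φ : StepFunction N) :
    MemLp (φ.integral W) 2 P :=
  memLp_finsetSum _ fun _ _ => (hW.memLp_boxIncrement _ _).const_mul _

theorem IsBrownianSheet.integral_boxIncrement (hW : IsBrownianSheet P W) (a b : Fin N → ℝ) :
    ∫ ω, boxIncrement W a b ω ∂P = 0 := by
  have := hW.gaussian.isProbabilityMeasure
  simp only [boxIncrement]
  rw [integral_finsetSum _ fun S _ => ((hW.memLp _).integrable one_le_two).const_mul _]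
  refine Finset.sum_eq_zero fun S _ => ?_
  rw [integral_const_mul, hW.mean, mul_zero]

theorem IsBrownianSheet.integral_stepIntegral (hW : IsBrownianSheet P W) (φ : StepFunction N) :
    ∫ ω, φ.integral W ω ∂P = 0 := by
  have := hW.gaussian.isProbabilityMeasure
  simp only [StepFunction.integral]
  rw [integral_finsetSum _ fun S _ =>
    ((hW.memLp_boxIncrement _ _).integrable one_le_two).const_mul _]
  refine Finset.sum_eq_zero fun S _ => ?_
  rw [integral_const_mul, hW.integral_boxIncrement, mul_zero]

theorem IsBrownianSheet.covariance_boxIncrement (hW : IsBrownianSheet P W)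
    {a b c d : Fin N → ℝ} (hab : a ≤ b) (hcd : c ≤ d) :
    covariance (boxIncrement W a b) (boxIncrement W c d) P =
      ∫ u, (Set.univ.pi fun i => Set.Ioc (a i) (b i)).indicator (fun _ => (1 : ℝ)) u *
        (Set.univ.pi fun i => Set.Ioc (c i) (d i)).indicator (fun _ => (1 : ℝ)) u := by
  have := hW.gaussian.isProbabilityMeasure
  have hR : ∫ u, (Set.univ.pi fun i => Set.Ioc (a i) (b i)).indicator (fun _ => (1 : ℝ)) u *
        (Set.univ.pi fun i => Set.Ioc (c i) (d i)).indicator (fun _ => (1 : ℝ)) u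
      = ∏ i, max (min (b i) (d i) - max (a i) (c i)) 0 := by
    have h1 : ∀ u, (Set.univ.pi fun i => Set.Ioc (a i) (b i)).indicator (fun _ => (1 : ℝ)) u *
        (Set.univ.pi fun i => Set.Ioc (c i) (d i)).indicator (fun _ => (1 : ℝ)) u
        = (Set.univ.pi fun i =>
          Set.Ioc (max (a i) (c i)) (min (b i) (d i))).indicator (1 : (Fin N → ℝ) → ℝ) u := by
      intro u
      have : (Set.univ.pi fun i => Set.Ioc (max (a i) (c i)) (min (b i) (d i)))
          = (Set.univ.pi fun i => Set.Ioc (a i) (b i)) ∩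
            (Set.univ.pi fun i => Set.Ioc (c i) (d i)) := by
        rw [← Set.pi_inter_distrib]
        simp only [Set.Ioc_inter_Ioc]
      rw [this, Set.inter_indicator_one]
      rfl
    simp_rw [h1]
    rw [integral_indicator_one (MeasurableSet.univ_pi fun _ => measurableSet_Ioc),
      Measure.real, Real.volume_pi_Ioc, ENNReal.toReal_prod]
    refine Finset.prod_congr rfl fun i _ => ?_
    exact ENNReal.toReal_ofReal'
  rw [hR]
  have e : ∀ a b : Fin N → ℝ, boxIncrement W a b
      = fun ω => ∑ S : Finset (Fin N), (-1 : ℝ) ^ S.card * W (S.piecewise a b) ω := fun _ _ => rfl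
  rw [e a b, e c d, covariance_fun_sum_fun_sum (fun S => (hW.memLp _).const_mul _)
    (fun S => (hW.memLp _).const_mul _)]
  simp_rw [covariance_const_mul_left, covariance_const_mul_right, hW.cov]
  simp_rw [← Finset.mul_sum]
  have h2 : ∀ S : Finset (Fin N), ∑ T : Finset (Fin N), (-1 : ℝ) ^ T.card *
      ∏ i, (|S.piecewise a b i| + |T.piecewise c d i| - |S.piecewise a b i - T.piecewise c d i|) / 2
      = ∏ i, ((|S.piecewise a b i| + |d i| - |S.piecewise a b i - d i|) / 2 -
        (|S.piecewise a b i| + |c i| - |S.piecewise a b i - c i|) / 2) := fun S =>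
    sum_neg_one_pow_mul_prod_piecewise
      (fun i y => (|S.piecewise a b i| + |y| - |S.piecewise a b i - y|) / 2) c d
  simp_rw [h2]
  rw [sum_neg_one_pow_mul_prod_piecewise
    (fun i x => (|x| + |d i| - |x - d i|) / 2 - (|x| + |c i| - |x - c i|) / 2) a b]
  exact Finset.prod_congr rfl fun i _ => abs_combination_eq_max (hab i) (hcd i)

theorem IsBrownianSheet.covariance_stepIntegral (hW : IsBrownianSheet P W)
    (φ ψ : StepFunction N) :
    covariance (φ.integral W) (ψ.integral W) P = ∫ u, φ.eval u * ψ.eval u := by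
  have := hW.gaussian.isProbabilityMeasure
  have e : ∀ φ : StepFunction N, φ.integral W
      = fun ω => ∑ j, φ.coeff j * boxIncrement W (φ.lower j) (φ.upper j) ω := fun _ => rfl
  rw [e φ, e ψ, covariance_fun_sum_fun_sum (fun S => (hW.memLp_boxIncrement _ _).const_mul _)
    (fun S => (hW.memLp_boxIncrement _ _).const_mul _)]
  simp_rw [covariance_const_mul_left, covariance_const_mul_right,
    hW.covariance_boxIncrement (φ.lower_le_upper _) (ψ.lower_le_upper _)]
  simp only [StepFunction.eval, Finset.sum_mul_sum]
  have hint : ∀ i j, Integrable (fun u =>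
      (Set.univ.pi fun k => Set.Ioc (φ.lower i k) (φ.upper i k)).indicator (fun _ => (1 : ℝ)) u *
      (Set.univ.pi fun k => Set.Ioc (ψ.lower j k) (ψ.upper j k)).indicator (fun _ => (1 : ℝ)) u) :=
    fun i j => (memLp_box_indicator _ _).integrable_mul (memLp_box_indicator _ _)
  have hint' : ∀ i j, Integrable (fun u => φ.coeff i *
      (Set.univ.pi fun k => Set.Ioc (φ.lower i k) (φ.upper i k)).indicator (fun _ => (1 : ℝ)) u *
      (ψ.coeff j *
      (Set.univ.pi fun k => Set.Ioc (ψ.lower j k) (ψ.upper j k)).indicator (fun _ => (1 : ℝ)) u)) :=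
    fun i j => ((hint i j).const_mul (φ.coeff i * ψ.coeff j)).congr
      (Eventually.of_forall fun u => by ring)
  rw [integral_finsetSum _ fun i _ => integrable_finsetSum _ fun j _ => hint' i j]
  refine Finset.sum_congr rfl fun i _ => ?_
  rw [integral_finsetSum _ fun j _ => hint' i j]
  refine Finset.sum_congr rfl fun j _ => ?_
  simp_rw [mul_mul_mul_comm, integral_const_mul]
  ring

theorem IsBrownianSheet.integral_sq_stepIntegral (hW : IsBrownianSheet P W)
    (φ : StepFunction N) : ∫ ω, φ.integral W ω ^ 2 ∂P = ∫ u, φ.eval u ^ 2 := by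
  have := hW.gaussian.isProbabilityMeasure
  have h := hW.covariance_stepIntegral φ φ
  rw [covariance_eq_sub (hW.memLp_integral φ) (hW.memLp_integral φ),
    hW.integral_stepIntegral, mul_zero, sub_zero] at h
  simp only [sq]
  exact h

theorem IsBrownianSheet.eLpNorm_stepIntegral (hW : IsBrownianSheet P W) (φ : StepFunction N) :
    eLpNorm (φ.integral W) 2 P = eLpNorm φ.eval 2 volume := by
  rw [eLpNorm_two_eq_ofReal_sqrt (hW.memLp_integral φ), eLpNorm_two_eq_ofReal_sqrt φ.memLp_eval,
    hW.integral_sq_stepIntegral]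

theorem IsBrownianSheet.isGaussianProcess_stepIntegral (hW : IsBrownianSheet P W) :
    IsGaussianProcess (fun φ : StepFunction N => φ.integral W) P := by
  classical
  refine hW.gaussian.of_isGaussianProcess fun φ => ?_
  let I : Finset (Fin N → ℝ) := Finset.univ.image fun p : Fin φ.n × Finset (Fin N) =>
    p.2.piecewise (φ.lower p.1) (φ.upper p.1)
  have hI : ∀ (j : Fin φ.n) (S : Finset (Fin N)), S.piecewise (φ.lower j) (φ.upper j) ∈ I := fun j S =>
    Finset.mem_image_of_mem (fun p : Fin φ.n × Finset (Fin N) =>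
      p.2.piecewise (φ.lower p.1) (φ.upper p.1)) (Finset.mem_univ (j, S))
  refine ⟨I, ∑ j, φ.coeff j • ∑ S : Finset (Fin N), (-1 : ℝ) ^ S.card •
    (ContinuousLinearMap.proj ⟨_, hI j S⟩ : (I → ℝ) →L[ℝ] ℝ), fun ω => ?_⟩
  simp [StepFunction.integral, boxIncrement]

theorem IsBrownianSheet.map_stepIntegral (hW : IsBrownianSheet P W) (φ : StepFunction N) :
    P.map (φ.integral W) = gaussianReal 0 (∫ u, φ.eval u ^ 2).toNNReal := by
  have := hW.gaussian.isProbabilityMeasure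
  rw [(hW.isGaussianProcess_stepIntegral.hasGaussianLaw_eval φ).map_eq_gaussianReal,
    hW.integral_stepIntegral, variance_of_integral_eq_zero (hW.memLp_integral φ).aemeasurable
      (hW.integral_stepIntegral φ), ← hW.integral_sq_stepIntegral]

end Isometry

/-! ### Wiener integrals: laws, existence, joint Gaussianity -/

section WienerIntegral

variable {N : ℕ} {Ω : Type*} [MeasurableSpace Ω] {P : Measure Ω} {W : (Fin N → ℝ) → Ω → ℝ}

theorem IsWienerIntegral.add (hW : IsBrownianSheet P W) {f g : (Fin N → ℝ) → ℝ} {I J : Ω → ℝ}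
    (hI : IsWienerIntegral P W f I) (hJ : IsWienerIntegral P W g J) :
    IsWienerIntegral P W (fun u => f u + g u) (fun ω => I ω + J ω) := by
  obtain ⟨hf, hI2, φ, hφ, hφ'⟩ := hI
  obtain ⟨hg, hJ2, ψ, hψ, hψ'⟩ := hJ
  refine ⟨hf.add hg, hI2.add hJ2, fun n => (φ n).add (ψ n), ?_, ?_⟩
  · refine tendsto_of_tendsto_of_tendsto_of_le_of_le tendsto_const_nhds
      (by simpa using hφ.add hψ) (fun _ => zero_le) fun n => ?_
    refine le_trans (le_of_eq ?_) (eLpNorm_add_le (hf.sub (φ n).memLp_eval).1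
      (hg.sub (ψ n).memLp_eval).1 one_le_two)
    congr 1
    funext u
    simp only [StepFunction.eval_add, Pi.add_apply]
    ring
  · refine tendsto_of_tendsto_of_tendsto_of_le_of_le tendsto_const_nhds
      (by simpa using hφ'.add hψ') (fun _ => zero_le) fun n => ?_
    refine le_trans (le_of_eq ?_) (eLpNorm_add_le (hI2.sub (hW.memLp_integral (φ n))).1
      (hJ2.sub (hW.memLp_integral (ψ n))).1 one_le_two)
    congr 1
    funext ω
    simp only [StepFunction.integral_add, Pi.add_apply]
    ring

theorem IsWienerIntegral.const_mul {f : (Fin N → ℝ) → ℝ} {I : Ω → ℝ}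
    (hI : IsWienerIntegral P W f I) (c : ℝ) :
    IsWienerIntegral P W (fun u => c * f u) (fun ω => c * I ω) := by
  obtain ⟨hf, hI2, φ, hφ, hφ'⟩ := hI
  refine ⟨hf.const_mul c, hI2.const_mul c, fun n => (φ n).smul c, ?_, ?_⟩
  · have h := ENNReal.Tendsto.const_mul (a := ‖c‖ₑ) hφ (Or.inr enorm_ne_top)
    rw [mul_zero] at h
    refine h.congr fun n => ?_
    rw [← eLpNorm_const_smul]
    congr 1
    funext u
    simp only [StepFunction.eval_smul, Pi.smul_apply, smul_eq_mul]
    ring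
  · have h := ENNReal.Tendsto.const_mul (a := ‖c‖ₑ) hφ' (Or.inr enorm_ne_top)
    rw [mul_zero] at h
    refine h.congr fun n => ?_
    rw [← eLpNorm_const_smul]
    congr 1
    funext u
    simp only [StepFunction.integral_smul, Pi.smul_apply, smul_eq_mul]
    ring

theorem IsWienerIntegral.zero :
    IsWienerIntegral P W (fun _ => (0 : ℝ)) (fun _ => (0 : ℝ)) := by
  refine ⟨MemLp.zero, MemLp.zero, fun _ => (StepFunction.box 0 0 le_rfl).smul 0, ?_, ?_⟩
  · simp [StepFunction.eval_smul]
  · simp [StepFunction.integral_smul]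

theorem IsWienerIntegral.sum (hW : IsBrownianSheet P W) {ι : Type*} (s : Finset ι)
    {f : ι → (Fin N → ℝ) → ℝ} {I : ι → Ω → ℝ} (hI : ∀ i, IsWienerIntegral P W (f i) (I i)) :
    IsWienerIntegral P W (fun u => ∑ i ∈ s, f i u) (fun ω => ∑ i ∈ s, I i ω) := by
  classical
  induction s using Finset.induction_on with
  | empty => simpa using IsWienerIntegral.zero
  | insert a s ha ih =>
    simp_rw [Finset.sum_insert ha]
    exact IsWienerIntegral.add hW (hI a) ih

theorem IsWienerIntegral.sum_mul (hW : IsBrownianSheet P W) {ι : Type*} (s : Finset ι)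
    (c : ι → ℝ) {f : ι → (Fin N → ℝ) → ℝ} {I : ι → Ω → ℝ}
    (hI : ∀ i, IsWienerIntegral P W (f i) (I i)) :
    IsWienerIntegral P W (fun u => ∑ i ∈ s, c i * f i u) (fun ω => ∑ i ∈ s, c i * I i ω) :=
  IsWienerIntegral.sum hW s fun i => (hI i).const_mul (c i)

/-- The Wiener integral of `f` is centred Gaussian with variance `∫ f²`. -/
theorem IsWienerIntegral.map_eq (hW : IsBrownianSheet P W) {f : (Fin N → ℝ) → ℝ} {I : Ω → ℝ}
    (hI : IsWienerIntegral P W f I) :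
    P.map I = gaussianReal 0 (∫ u, f u ^ 2).toNNReal := by
  have := hW.gaussian.isProbabilityMeasure
  obtain ⟨hf, hI2, φ, hφ, hφ'⟩ := hI
  have hmeas : TendstoInMeasure P (fun n => (φ n).integral W) atTop I := by
    refine tendstoInMeasure_of_tendsto_eLpNorm two_ne_zero
      (fun n => (hW.memLp_integral (φ n)).1) hI2.1 ?_
    refine hφ'.congr fun n => ?_
    rw [eLpNorm_sub_comm, Pi.sub_def]
  -- Convergence in `L²` implies convergence in law, and the characteristic functions of the
  -- Gaussian approximations converge along with their variances.
  have hdist := hmeas.tendstoInDistribution fun n => (hW.memLp_integral (φ n)).aemeasurable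
  have hchar := ProbabilityMeasure.tendsto_iff_tendsto_charFun.1 hdist.tendsto
  have : IsProbabilityMeasure (P.map I) := Measure.isProbabilityMeasure_map hI2.aemeasurable
  refine Measure.ext_of_charFun (funext fun t => ?_)
  refine tendsto_nhds_unique (hchar t) ?_
  simp only [ProbabilityMeasure.coe_mk, hW.map_stepIntegral, charFun_gaussianReal]
  have hv := tendsto_integral_sq_of_tendsto_eLpNorm_sub hf (fun n => (φ n).memLp_eval) hφ
  have hv' : Tendsto (fun n => (((∫ u, (φ n).eval u ^ 2).toNNReal : ℝ) : ℂ)) atTop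
      (𝓝 (((∫ u, f u ^ 2).toNNReal : ℝ) : ℂ)) := by
    exact (Complex.continuous_ofReal.tendsto _).comp
      ((NNReal.continuous_coe.tendsto _).comp ((continuous_real_toNNReal.tendsto _).comp hv))
  exact (Complex.continuous_exp.tendsto _).comp
    (tendsto_const_nhds.sub ((hv'.mul_const _).div_const _))

theorem IsWienerIntegral.variance_eq (hW : IsBrownianSheet P W) {f : (Fin N → ℝ) → ℝ}
    {I : Ω → ℝ} (hI : IsWienerIntegral P W f I) : variance I P = ∫ u, f u ^ 2 := by
  have h := variance_map (μ := P) (X := fun x : ℝ => x) (by fun_prop) hI.2.1.aemeasurable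
  have h' : variance (fun x : ℝ => x) (P.map I) = ∫ u, f u ^ 2 := by
    rw [hI.map_eq hW, variance_fun_id_gaussianReal,
      Real.coe_toNNReal _ (integral_nonneg fun u => sq_nonneg _)]
  rw [← h', h]
  rfl

/-- The Itô isometry. -/
theorem IsWienerIntegral.covariance_eq (hW : IsBrownianSheet P W) {f g : (Fin N → ℝ) → ℝ}
    {I J : Ω → ℝ} (hI : IsWienerIntegral P W f I) (hJ : IsWienerIntegral P W g J) :
    covariance I J P = ∫ u, f u * g u := by
  have := hW.gaussian.isProbabilityMeasure
  -- Polarization: the variance of `I + J`, itself a Wiener integral, is computed in two ways.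
  have h1 : variance (fun ω => I ω + J ω) P = _ := variance_add hI.2.1 hJ.2.1
  rw [(hI.add hW hJ).variance_eq hW, hI.variance_eq hW, hJ.variance_eq hW] at h1
  have h2 : ∫ u, (f u + g u) ^ 2 = (∫ u, f u ^ 2) + 2 * (∫ u, f u * g u) + ∫ u, g u ^ 2 := by
    have hfg : Integrable (fun u => f u * g u) := hI.1.integrable_mul hJ.1
    rw [← integral_const_mul, ← integral_add hI.1.integrable_sq (hfg.const_mul 2),
      ← integral_add (f := fun u => f u ^ 2 + 2 * (f u * g u))
        (hI.1.integrable_sq.add (hfg.const_mul 2)) hJ.1.integrable_sq]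
    congr 1
    funext u
    ring
  linarith

/-- The isometry carries a convergent sequence of step functions to a Cauchy sequence in `L²(P)`,
which is complete. -/
theorem exists_isWienerIntegral (hW : IsBrownianSheet P W) {f : (Fin N → ℝ) → ℝ}
    (hf : MemLp f 2 volume) : ∃ I, IsWienerIntegral P W f I := by
  obtain ⟨φ, hφ⟩ := exists_stepFunction_tendsto hf
  have hF : Tendsto (fun n => (φ n).toLp) atTop (𝓝 (hf.toLp f)) := by
    refine (Lp.tendsto_Lp_iff_tendsto_eLpNorm'' _ (fun n => (φ n).memLp_eval) f hf).2 ?_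
    refine hφ.congr fun n => ?_
    rw [eLpNorm_sub_comm, Pi.sub_def]
  let G : ℕ → Lp ℝ 2 P := fun n => (hW.memLp_integral (φ n)).toLp _
  have hdist : ∀ m n, edist (G m) (G n) = edist (φ m).toLp (φ n).toLp := by
    intro m n
    have h := hW.eLpNorm_stepIntegral ((φ m).add ((φ n).smul (-1)))
    rw [Lp.edist_toLp_toLp, StepFunction.toLp, StepFunction.toLp, Lp.edist_toLp_toLp]
    convert h using 2
    · funext ω
      simp [StepFunction.integral_add, StepFunction.integral_smul, sub_eq_add_neg]
    · funext u
      simp [StepFunction.eval_add, StepFunction.eval_smul, sub_eq_add_neg]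
  have hG : CauchySeq G := by
    have hc := hF.cauchySeq
    rw [EMetric.cauchySeq_iff] at hc ⊢
    simpa only [hdist] using hc
  obtain ⟨I, hI⟩ := cauchySeq_tendsto_of_complete hG
  refine ⟨I, hf, Lp.memLp I, φ, hφ, ?_⟩
  rw [← Lp.toLp_coeFn I (Lp.memLp I)] at hI
  refine ((Lp.tendsto_Lp_iff_tendsto_eLpNorm'' _ (fun n => hW.memLp_integral (φ n)) _
    (Lp.memLp I)).1 hI).congr fun n => ?_
  rw [eLpNorm_sub_comm, Pi.sub_def]

theorem isWienerIntegral_wienerIntegral (hW : IsBrownianSheet P W) {f : (Fin N → ℝ) → ℝ}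
    (hf : MemLp f 2 volume) : IsWienerIntegral P W f (wienerIntegral P W f) := by
  have h := exists_isWienerIntegral hW hf
  rw [wienerIntegral, dif_pos h]
  exact h.choose_spec

/-- A Wiener integral is fixed only up to null sets, so independence of `Y₀` from `W` does not apply
to it directly. A `σ(W)`-measurable version exists because the `σ(W)`-measurable classes are closed
in `L²`. -/
theorem IsWienerIntegral.exists_measurable_comap (hW : IsBrownianSheet P W)
    {f : (Fin N → ℝ) → ℝ} {I : Ω → ℝ} (hI : IsWienerIntegral P W f I) :
    ∃ J, Measurable[MeasurableSpace.comap (fun ω t => W t ω) inferInstance] J ∧ I =ᵐ[P] J := by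
  obtain ⟨hf, hI2, φ, hφ, hφ'⟩ := hI
  have hm : MeasurableSpace.comap (fun ω t => W t ω) inferInstance ≤ ‹MeasurableSpace Ω› :=
    (measurable_pi_lambda _ hW.measurable).comap_le
  have hWm : ∀ t, Measurable[MeasurableSpace.comap (fun ω t => W t ω) inferInstance] (W t) :=
    fun t => (measurable_pi_apply t).comp (comap_measurable (fun ω t => W t ω))
  have hlim : Tendsto (fun n => (hW.memLp_integral (φ n)).toLp ((φ n).integral W)) atTop
      (𝓝 (hI2.toLp I)) := by
    refine (Lp.tendsto_Lp_iff_tendsto_eLpNorm'' _ (fun n => hW.memLp_integral (φ n)) I hI2).2 ?_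
    refine hφ'.congr fun n => ?_
    rw [eLpNorm_sub_comm, Pi.sub_def]
  have hmem := (isClosed_aestronglyMeasurable (F := ℝ) (p := 2) (μ := P) hm).mem_of_tendsto hlim
    (Eventually.of_forall fun n => by
      refine AEStronglyMeasurable.congr ?_ (hW.memLp_integral (φ n)).coeFn_toLp.symm
      refine StronglyMeasurable.aestronglyMeasurable (Measurable.stronglyMeasurable ?_)
      exact Finset.measurable_sum _ fun j _ => Measurable.const_mul
        (Finset.measurable_sum _ fun S _ => (hWm _).const_mul _) _)
  obtain ⟨J, hJ, hIJ⟩ := hmem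
  exact ⟨J, hJ.measurable, hI2.coeFn_toLp.symm.trans hIJ⟩

/-- Wiener integrals form a Gaussian process. -/
theorem isGaussianProcess_of_isWienerIntegral (hW : IsBrownianSheet P W) {ι : Type*}
    {f : ι → (Fin N → ℝ) → ℝ} {I : ι → Ω → ℝ} (hI : ∀ i, IsWienerIntegral P W (f i) (I i)) :
    IsGaussianProcess I P := by
  classical
  refine ⟨fun s => ⟨isGaussian_of_map_eq_gaussianReal fun L => ?_⟩⟩
  have hmeas : AEMeasurable (fun ω => s.restrict (I · ω)) P :=
    aemeasurable_pi_lambda _ fun i => (hI i).2.1.aemeasurable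
  rw [AEMeasurable.map_map_of_aemeasurable L.continuous.measurable.aemeasurable hmeas]
  -- A linear functional of finitely many Wiener integrals is again a Wiener integral, hence
  -- Gaussian.
  have hL : (L ∘ fun ω => s.restrict (I · ω))
      = fun ω => ∑ i : s, L (Pi.single i 1) * I i ω := by
    funext ω
    simp only [Function.comp_apply]
    conv_lhs => rw [← Finset.univ_sum_single (s.restrict (I · ω)), map_sum]
    refine Finset.sum_congr rfl fun i _ => ?_
    have : (Pi.single i (s.restrict (I · ω) i) : s → ℝ) = I i ω • Pi.single i (1 : ℝ) := by
      rw [← Pi.single_smul, smul_eq_mul, mul_one]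
      rfl
    rw [this, map_smul, smul_eq_mul, mul_comm]
  rw [hL]
  exact ⟨_, _, (IsWienerIntegral.sum_mul hW Finset.univ (fun i : s => L (Pi.single i 1))
    fun i : s => hI i).map_eq hW⟩

end WienerIntegral

/-! ### The covariance kernel of the exponential integrands -/

section Integrand

variable {N : ℕ} {α : Fin N → ℝ}

theorem indicator_Iic_exp_eq_prod (α r u : Fin N → ℝ) :
    (Set.Iic r).indicator (fun u => Real.exp (∑ i, 2 * α i * u i)) u =
      ∏ i, (Set.Iic (r i)).indicator (fun x => Real.exp (2 * α i * x)) (u i) := by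
  by_cases h : u ≤ r
  · rw [Set.indicator_of_mem (show u ∈ Set.Iic r from h), Real.exp_sum]
    exact Finset.prod_congr rfl fun i _ =>
      (Set.indicator_of_mem (show u i ∈ Set.Iic (r i) from h i)
        fun x => Real.exp (2 * α i * x)).symm
  · rw [Set.indicator_of_notMem (show u ∉ Set.Iic r from h)]
    obtain ⟨i, hi⟩ := not_forall.1 h
    exact (Finset.prod_eq_zero (Finset.mem_univ i)
      (Set.indicator_of_notMem (show u i ∉ Set.Iic (r i) from hi) _)).symm

theorem integrable_indicator_Iic_exp (hα : ∀ i, 0 < α i) (r : Fin N → ℝ) :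
    Integrable ((Set.Iic r).indicator fun u : Fin N → ℝ => Real.exp (∑ i, 2 * α i * u i)) := by
  have h := Integrable.fintype_prod (μ := fun _ : Fin N => (volume : Measure ℝ))
    (f := fun i => (Set.Iic (r i)).indicator (fun x => Real.exp (2 * α i * x))) fun i =>
    (integrable_indicator_iff measurableSet_Iic).2
      (integrableOn_exp_mul_Iic (mul_pos two_pos (hα i)) (r i))
  rw [volume_pi]
  refine h.congr (Eventually.of_forall fun u => ?_)
  exact (indicator_Iic_exp_eq_prod α r u).symm

theorem integral_indicator_Iic_exp (hα : ∀ i, 0 < α i) (r : Fin N → ℝ) :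
    ∫ u, (Set.Iic r).indicator (fun u : Fin N → ℝ => Real.exp (∑ i, 2 * α i * u i)) u =
      Real.exp (2 * ∑ i, α i * r i) / ∏ i, (2 * α i) := by
  simp_rw [indicator_Iic_exp_eq_prod]
  rw [integral_fintype_prod_volume_eq_prod
    (fun i => (Set.Iic (r i)).indicator (fun x => Real.exp (2 * α i * x)))]
  simp_rw [integral_indicator measurableSet_Iic]
  rw [Finset.mul_sum, Real.exp_sum, ← Finset.prod_div_distrib]
  refine Finset.prod_congr rfl fun i _ => ?_
  rw [integral_exp_mul_Iic (mul_pos two_pos (hα i)), mul_assoc]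

/-- Since `(-∞,s] ∩ (-∞,t] = (-∞, s ⊓ t]`, products of integrands depend on `s` and `t` through `s ⊓
t` alone. -/
theorem ouIntegrand_mul (α : Fin N → ℝ) (s t : Fin N → ℝ≥0) (u : Fin N → ℝ) :
    ouIntegrand α s u * ouIntegrand α t u =
      (Set.Iic (toReals (s ⊓ t))).indicator (fun u => Real.exp (∑ i, 2 * α i * u i)) u -
        (Set.Iic 0).indicator (fun u => Real.exp (∑ i, 2 * α i * u i)) u := by
  have hexp : Real.exp (∑ i, 2 * α i * u i)
      = Real.exp (∑ i, α i * u i) * Real.exp (∑ i, α i * u i) := by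
    rw [← Real.exp_add, ← two_mul, Finset.mul_sum]
    simp only [mul_assoc]
  have hle : u ≤ toReals (s ⊓ t) ↔ u ≤ toReals s ∧ u ≤ toReals t := by
    have : toReals (s ⊓ t) = toReals s ⊓ toReals t := by
      funext i
      exact NNReal.coe_min _ _
    rw [this, le_inf_iff]
  have h0 : ∀ t : Fin N → ℝ≥0, u ≤ 0 → u ≤ toReals t := fun t h => h.trans fun i => (t i).2
  classical
  simp only [ouIntegrand, Set.indicator_apply, Set.mem_sdiff, Set.mem_Iic, hle, hexp]
  by_cases hu : u ≤ 0
  · simp [hu, h0 s hu, h0 t hu]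
  · by_cases hs : u ≤ toReals s <;> by_cases ht : u ≤ toReals t <;> simp [hu, hs, ht]

theorem measurable_ouIntegrand (α : Fin N → ℝ) (t : Fin N → ℝ≥0) :
    Measurable (ouIntegrand α t) :=
  Measurable.indicator (by fun_prop) (measurableSet_Iic.diff measurableSet_Iic)

theorem memLp_ouIntegrand (hα : ∀ i, 0 < α i) (t : Fin N → ℝ≥0) :
    MemLp (ouIntegrand α t) 2 volume := by
  rw [memLp_two_iff_integrable_sq (measurable_ouIntegrand α t).aestronglyMeasurable]
  simp_rw [sq, ouIntegrand_mul]
  exact (integrable_indicator_Iic_exp hα _).sub (integrable_indicator_Iic_exp hα _)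

theorem integral_ouIntegrand_mul (hα : ∀ i, 0 < α i) (s t : Fin N → ℝ≥0) :
    ∫ u, ouIntegrand α s u * ouIntegrand α t u =
      (Real.exp (2 * ∑ i, α i * ((s ⊓ t) i : ℝ)) - 1) / ∏ i, (2 * α i) := by
  simp_rw [ouIntegrand_mul]
  rw [integral_sub (integrable_indicator_Iic_exp hα _) (integrable_indicator_Iic_exp hα _),
    integral_indicator_Iic_exp hα, integral_indicator_Iic_exp hα, ← sub_div]
  simp [toReals]

end Integrand

/-! ### Conditional laws with an independent Gaussian residual -/

section Conditioning

variable {Ω : Type*} {m₀ : MeasurableSpace Ω} {P : Measure Ω}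

theorem lintegral_gaussianReal_eq_lintegral_add (f : ℝ → ℝ≥0∞) (hf : Measurable f) (x : ℝ)
    (v : ℝ≥0) : ∫⁻ y, f y ∂(gaussianReal x v) = ∫⁻ y, f (x + y) ∂(gaussianReal 0 v) := by
  have h := gaussianReal_map_const_add (μ := 0) (v := v) x
  rw [zero_add] at h
  rw [← h, lintegral_map hf (by fun_prop)]

theorem measurable_lintegral_gaussianReal (f : ℝ → ℝ≥0∞) (hf : Measurable f) (v : ℝ≥0) :
    Measurable fun x => ∫⁻ y, f y ∂(gaussianReal x v) := by
  simp_rw [lintegral_gaussianReal_eq_lintegral_add f hf]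
  exact Measurable.lintegral_prod_right' (f := fun p : ℝ × ℝ => f (p.1 + p.2)) (by fun_prop)

/-- If `X - M` is centred Gaussian and independent of `m`, and `M` is `m`-measurable, then the
conditional law of `X` given `m` is Gaussian with mean `M`. -/
theorem condLExp_eq_lintegral_gaussianReal {m m₀ : MeasurableSpace Ω} {P : Measure Ω}
    [IsProbabilityMeasure P] (hm : m ≤ m₀) {X M : Ω → ℝ} (hX : Measurable X) (hM : Measurable[m] M) {v : ℝ≥0}
    (hlaw : P.map (fun ω => X ω - M ω) = gaussianReal 0 v)
    (hind : Indep m (MeasurableSpace.comap (fun ω => X ω - M ω) inferInstance) P)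
    {f : ℝ → ℝ≥0∞} (hf : Measurable f) :
    condLExp m P (fun ω => f (X ω)) =ᵐ[P] fun ω => ∫⁻ y, f y ∂(gaussianReal (M ω) v) := by
  have hM' : Measurable M := hM.mono hm le_rfl
  refine (ae_eq_condLExp (Y := fun ω => ∫⁻ y, f y ∂(gaussianReal (M ω) v)) hm P _
    ((measurable_lintegral_gaussianReal f hf v).comp hM)
    fun s hs => ?_).symm
  -- The indicator of the test event is bundled with `M`: both are `m`-measurable, so the pair is
  -- independent of the residual and Tonelli applies to the product law.
  let V : Ω → ℝ≥0∞ × ℝ := fun ω => (s.indicator (fun _ => 1) ω, M ω)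
  have hVm : Measurable[m] V :=
    Measurable.prodMk (m := m) (measurable_const.indicator hs) hM
  have hV : Measurable V := hVm.mono hm le_rfl
  have hξ : Measurable fun ω => X ω - M ω := hX.sub hM'
  have hVξ : IndepFun V (fun ω => X ω - M ω) P :=
    (IndepFun_iff_Indep _ _ _).2 (indep_of_indep_of_le_left hind hVm.comap_le)
  have hprod := (indepFun_iff_map_prod_eq_prod_map_map hV.aemeasurable hξ.aemeasurable).1 hVξ
  rw [← lintegral_indicator (hm s hs), ← lintegral_indicator (hm s hs)]
  have h1 : ∀ ω, s.indicator (fun ω => f (X ω)) ω = (V ω).1 * f ((V ω).2 + (X ω - M ω)) := by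
    intro ω
    by_cases h : ω ∈ s <;> simp [V, h]
  have h2 : ∀ ω, s.indicator (fun ω => ∫⁻ y, f y ∂(gaussianReal (M ω) v)) ω
      = (V ω).1 * ∫⁻ y, f ((V ω).2 + y) ∂(gaussianReal 0 v) := by
    intro ω
    by_cases h : ω ∈ s <;> simp [V, h, lintegral_gaussianReal_eq_lintegral_add f hf]
  have hF : Measurable fun p : (ℝ≥0∞ × ℝ) × ℝ => p.1.1 * f (p.1.2 + p.2) := by fun_prop
  have h3 : ∫⁻ ω, (V ω).1 * f ((V ω).2 + (X ω - M ω)) ∂P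
      = ∫⁻ p, p.1.1 * f (p.1.2 + p.2) ∂(P.map fun ω => (V ω, X ω - M ω)) :=
    (lintegral_map hF (hV.prodMk hξ)).symm
  have h4 : ∫⁻ ω, (V ω).1 * ∫⁻ y, f ((V ω).2 + y) ∂(gaussianReal 0 v) ∂P
      = ∫⁻ q, q.1 * ∫⁻ y, f (q.2 + y) ∂(gaussianReal 0 v) ∂(P.map V) := by
    refine (lintegral_map (f := fun q : ℝ≥0∞ × ℝ =>
      q.1 * ∫⁻ y, f (q.2 + y) ∂(gaussianReal 0 v)) ?_ hV).symm
    exact measurable_fst.mul (Measurable.lintegral_prod_right'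
      (f := fun p : (ℝ≥0∞ × ℝ) × ℝ => f (p.1.2 + p.2)) (by fun_prop))
  simp_rw [h1, h2]
  rw [h3, h4, hprod, hlaw, lintegral_prod _ hF.aemeasurable]
  refine lintegral_congr fun q => ?_
  exact (lintegral_const_mul _ (by fun_prop)).symm

/-- This serves to add `Y₀` to the past: `X` will be the increment, `Z` the integrals on the past
and `Y` the initial value. -/
theorem IndepFun.prodMk_of_indepFun_prodMk {A B C : Type*} [MeasurableSpace A]
    [MeasurableSpace B] [MeasurableSpace C] [IsProbabilityMeasure P] {X : Ω → A} {Y : Ω → B}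
    {Z : Ω → C} (hX : Measurable X) (hY : Measurable Y) (hZ : Measurable Z)
    (hXZ : IndepFun X Z P) (hY' : IndepFun Y (fun ω => (X ω, Z ω)) P) :
    IndepFun X (fun ω => (Y ω, Z ω)) P := by
  rw [indepFun_iff_map_prod_eq_prod_map_map hX.aemeasurable (hY.prodMk hZ).aemeasurable]
  have hYZ : IndepFun Y Z P := hY'.comp measurable_id measurable_snd
  have : IsProbabilityMeasure (P.map fun ω => (X ω, Y ω, Z ω)) :=
    Measure.isProbabilityMeasure_map (hX.prodMk (hY.prodMk hZ)).aemeasurable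
  refine Measure.ext_prod₃ fun {s t u} hs ht hu => ?_
  rw [Measure.map_apply (hX.prodMk (hY.prodMk hZ)) (hs.prod (ht.prod hu)), Measure.prod_prod,
    Measure.map_apply hX hs, Measure.map_apply (hY.prodMk hZ) (ht.prod hu)]
  have e1 : (fun ω => (X ω, Y ω, Z ω)) ⁻¹' s ×ˢ t ×ˢ u
      = Y ⁻¹' t ∩ (fun ω => (X ω, Z ω)) ⁻¹' (s ×ˢ u) := by
    ext ω; simp only [Set.mem_preimage, Set.mem_prod, Set.mem_inter_iff]; tauto
  have e2 : (fun ω => (X ω, Z ω)) ⁻¹' (s ×ˢ u) = X ⁻¹' s ∩ Z ⁻¹' u := rfl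
  have e3 : (fun ω => (Y ω, Z ω)) ⁻¹' (t ×ˢ u) = Y ⁻¹' t ∩ Z ⁻¹' u := rfl
  rw [e1, hY'.measure_inter_preimage_eq_mul _ _ ht (hs.prod hu), e2,
    hXZ.measure_inter_preimage_eq_mul _ _ hs hu, e3, hYZ.measure_inter_preimage_eq_mul _ _ ht hu]
  ring

end Conditioning

/-! ### Collapse of the alternating sums over corners -/

section Alternating

variable {N : ℕ}

/-- The corner `t` of the rectangle `[0,t]`. -/
noncomputable def corner (U : Set (Fin N → ℝ≥0)) : Fin N → ℝ≥0 :=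
  Function.invFun (fun t : Fin N → ℝ≥0 => Set.Icc 0 t) U

theorem corner_Icc (t : Fin N → ℝ≥0) : corner (Set.Icc 0 t) = t :=
  Function.leftInverse_invFun Icc_zero_injective t

/-- The nonempty subfamilies of `B`. -/
noncomputable def subfamilies (B : Finset (Set (Fin N → ℝ≥0))) :
    Finset (Finset (Set (Fin N → ℝ≥0))) :=
  open Classical in B.powerset.filter fun S => S.Nonempty

theorem mem_subfamilies {B S : Finset (Set (Fin N → ℝ≥0))} :
    S ∈ subfamilies B ↔ S ⊆ B ∧ S.Nonempty := by
  classical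
  simp [subfamilies]

theorem sInter_eq_Icc_corner {B S : Finset (Set (Fin N → ℝ≥0))} (hB : ∀ U ∈ B, U ∈ rectangles N)
    (hS : S ∈ subfamilies B) :
    ⋂₀ (S : Set (Set (Fin N → ℝ≥0))) = Set.Icc 0 (corner (⋂₀ (S : Set (Set (Fin N → ℝ≥0))))) := by
  obtain ⟨hSB, hSn⟩ := mem_subfamilies.1 hS
  obtain ⟨s, hs⟩ := exists_sInter_eq_Icc hSn fun U hU => hB U (hSB hU)
  rw [hs, corner_Icc]

theorem corner_sInter_le {B S : Finset (Set (Fin N → ℝ≥0))} (hB : ∀ U ∈ B, U ∈ rectangles N)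
    (hS : S ∈ subfamilies B) {b : Fin N → ℝ≥0} (hb : Set.Icc 0 b ∈ S) :
    corner (⋂₀ (S : Set (Set (Fin N → ℝ≥0)))) ≤ b := by
  rw [← Icc_zero_subset_iff, ← sInter_eq_Icc_corner hB hS]
  exact Set.sInter_subset_of_mem hb

/-- Every corner `s` of a subfamily is at most `t`, so `u ⊓ s ≤ u ⊓ t ≤ b` and intersecting further
with `[0,b]` changes nothing. The sum collapses to the term of `{[0,b]}`, where `u ⊓ b = u ⊓ t`. The
hypothesis `u ⊓ t ≤ b` reflects that `[0,u]` misses the increment. -/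
theorem sum_subfamilies_inf {t : Fin N → ℝ≥0} {B : Finset (Set (Fin N → ℝ≥0))}
    (hB : IsExtremalIn (rectangles N) (Set.Icc 0 t) B) {u b : Fin N → ℝ≥0}
    (hb : Set.Icc 0 b ∈ B) (hub : u ⊓ t ≤ b) (h : (Fin N → ℝ≥0) → ℝ) :
    ∑ S ∈ subfamilies B, (-1 : ℝ) ^ (S.card + 1) *
      h (u ⊓ corner (⋂₀ (S : Set (Set (Fin N → ℝ≥0))))) = h (u ⊓ t) := by
  classical
  have hle : ∀ c, Set.Icc 0 c ∈ B → c ≤ t := fun c hc =>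
    Icc_zero_subset_iff.1 ((Set.subset_sUnion_of_mem hc).trans hB.subset)
  have key := sum_powerset_nonempty_eq_singleton B hb
    (fun S => h (u ⊓ corner (⋂₀ (S : Set (Set (Fin N → ℝ≥0)))))) (by
      intro S hSB hS
      obtain ⟨s, hs⟩ := exists_sInter_eq_Icc hS fun U hU => hB.mem U (hSB hU)
      rw [Finset.coe_insert, Set.sInter_insert, hs, Icc_zero_inter, corner_Icc, corner_Icc]
      congr 1
      obtain ⟨V, hV⟩ := hS
      obtain ⟨c, rfl⟩ := hB.mem V (hSB hV)
      have hst : s ≤ t := (Icc_zero_subset_iff.1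
        (hs ▸ Set.sInter_subset_of_mem (Finset.mem_coe.2 hV))).trans (hle c (hSB hV))
      have : u ⊓ s ≤ b := (inf_le_inf_left u hst).trans hub
      rw [inf_left_comm, inf_eq_right.2 this])
  rw [Finset.coe_singleton, Set.sInter_singleton, corner_Icc] at key
  have hut : u ⊓ b = u ⊓ t :=
    le_antisymm (inf_le_inf_left u (hle b hb)) (le_inf inf_le_left hub)
  rw [hut] at key
  rw [← key, subfamilies]

theorem sum_subfamilies_sign {t : Fin N → ℝ≥0} {B : Finset (Set (Fin N → ℝ≥0))}
    (hB : IsExtremalIn (rectangles N) (Set.Icc 0 t) B) :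
    ∑ S ∈ subfamilies B, (-1 : ℝ) ^ (S.card + 1) = 1 := by
  obtain ⟨U, hU⟩ := hB.nonempty
  obtain ⟨b, rfl⟩ := hB.mem U hU
  simpa using sum_subfamilies_inf hB (u := b) hU inf_le_left fun _ => 1

variable {α : Fin N → ℝ}

theorem sum_borderSets_eq_sum_subfamilies (hN : 1 ≤ N) {B : Finset (Set (Fin N → ℝ≥0))}
    (hB : ∀ U ∈ B, U ∈ rectangles N) (h : Set (Fin N → ℝ≥0) → ℝ) :
    ∑ U ∈ borderSets B, inclExclCoeff B U * h U = ∑ S ∈ subfamilies B,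
      (-1 : ℝ) ^ (S.card + 1) * h (Set.Icc 0 (corner (⋂₀ (S : Set (Set (Fin N → ℝ≥0)))))) := by
  rw [sum_borderSets hN hB]
  have : ∀ S ∈ subfamilies B, (-1 : ℝ) ^ (S.card + 1) * h (⋂₀ (S : Set (Set (Fin N → ℝ≥0))))
      = (-1 : ℝ) ^ (S.card + 1) *
        h (Set.Icc 0 (corner (⋂₀ (S : Set (Set (Fin N → ℝ≥0)))))) := fun S hS => by
    rw [← sInter_eq_Icc_corner hB hS]
  rw [← Finset.sum_congr rfl this, subfamilies]

theorem transitionMean_rectangles (hN : 1 ≤ N) (hα : ∀ i, 0 < α i) (t : Fin N → ℝ≥0)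
    {B : Finset (Set (Fin N → ℝ≥0))} (hB : ∀ U ∈ B, U ∈ rectangles N) {Ω : Type*}
    (X : Set (Fin N → ℝ≥0) → Ω → ℝ) (ω : Ω) :
    transitionMean (axisMeasureNonneg α) 1 (Set.Icc 0 t) B (borderVector X B ω) =
      Real.exp (-∑ i, α i * t i) * ∑ S ∈ subfamilies B, (-1 : ℝ) ^ (S.card + 1) *
        (X (Set.Icc 0 (corner (⋂₀ (S : Set (Set (Fin N → ℝ≥0)))))) ω *
          Real.exp (∑ i, α i * (corner (⋂₀ (S : Set (Set (Fin N → ℝ≥0)))) i : ℝ))) := by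
  rw [transitionMean, axisMeasureNonneg_real_Icc hα, neg_one_mul]
  congr 1
  simp only [borderVector, one_mul, mul_assoc]
  rw [Finset.sum_attach (borderSets B) fun U =>
    inclExclCoeff B U * (X U ω * Real.exp ((axisMeasureNonneg α).real U)),
    sum_borderSets_eq_sum_subfamilies hN hB]
  simp_rw [axisMeasureNonneg_real_Icc hα]

/-- With `λ = 1`, the value of `σ̃` is the one for which `σ̃² / (2λ) = σ² / ∏ 2αᵢ`, the prefactor
produced by the isometry. -/
theorem transitionVariance_rectangles (hN : 1 ≤ N) (hα : ∀ i, 0 < α i) (t : Fin N → ℝ≥0)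
    {B : Finset (Set (Fin N → ℝ≥0))} (hB : ∀ U ∈ B, U ∈ rectangles N) (σ : ℝ) :
    transitionVariance (axisMeasureNonneg α) 1 (√(2 * σ ^ 2 / ∏ i, (2 * α i))) (Set.Icc 0 t) B =
      σ ^ 2 / (∏ i, (2 * α i)) * (1 - Real.exp (-2 * ∑ i, α i * t i) *
        ∑ S ∈ subfamilies B, (-1 : ℝ) ^ (S.card + 1) *
          Real.exp (2 * ∑ i, α i * (corner (⋂₀ (S : Set (Set (Fin N → ℝ≥0)))) i : ℝ))) := by
  have hprod : 0 < ∏ i, (2 * α i) := Finset.prod_pos fun i _ => mul_pos two_pos (hα i)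
  rw [transitionVariance, Real.sq_sqrt (by positivity), axisMeasureNonneg_real_Icc hα,
    sum_borderSets_eq_sum_subfamilies hN hB]
  simp_rw [axisMeasureNonneg_real_Icc hα, mul_one]
  congr 1
  field_simp

end Alternating

/-! ### The strong past and its generators -/

section StrongPast

variable {T Ω : Type*} {𝒜 : Set (Set T)} {X : Set T → Ω → ℝ}

theorem comap_le_strongPast {U V C : Set T} (hU : U ∈ 𝒜) (hV : V ∈ 𝒜) (hUV : U ⊆ V)
    (hVC : V ∩ C = ∅) : MeasurableSpace.comap (X U) inferInstance ≤ strongPast 𝒜 X C := by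
  have hVu : V ∈ finiteUnions 𝒜 := ⟨{V}, by simp, by simpa using hV, by simp⟩
  refine le_trans ?_ (le_iSup₂_of_le V ⟨hVu, hVC⟩ le_rfl)
  refine le_trans ?_ (le_iSup₂_of_le U ⟨hU, hUV⟩ le_rfl)
  exact le_iSup₂_of_le U ⟨hU, subset_rfl⟩ le_rfl

theorem strongPast_le {m : MeasurableSpace Ω} {C : Set T}
    (h : ∀ U ∈ 𝒜, U ∩ C = ∅ → MeasurableSpace.comap (X U) inferInstance ≤ m) :
    strongPast 𝒜 X C ≤ m := by
  refine iSup₂_le fun B hB => iSup₂_le fun A hA => iSup₂_le fun U hU => h U hU.1 ?_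
  exact Set.subset_eq_empty (Set.inter_subset_inter_left C (hU.2.trans hA.2)) hB.2

theorem exists_subset_of_mem_borderSets [TopologicalSpace T] {B : Finset (Set T)} {U : Set T}
    (hU : U ∈ borderSets B) :
    ∃ S : Finset (Set T), S ⊆ B ∧ S.Nonempty ∧ U = ⋂₀ (S : Set (Set T)) := by
  classical
  obtain ⟨S, hS, rfl⟩ := Finset.mem_image.1 (Finset.mem_filter.1 hU).1
  obtain ⟨hSB, hSn⟩ := Finset.mem_filter.1 hS
  exact ⟨S, Finset.mem_powerset.1 hSB, hSn, rfl⟩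

theorem measurable_transitionMean [TopologicalSpace T] [MeasurableSpace T] (m : Measure T)
    (lam : ℝ) (A : Set T) (B : Finset (Set T)) : Measurable (transitionMean m lam A B) := by
  unfold transitionMean
  fun_prop

end StrongPast

theorem measurable_pi_of_forall {Ω ι : Type*} {π : ι → Type*} {m : MeasurableSpace Ω}
    [∀ i, MeasurableSpace (π i)] {f : Ω → ∀ i, π i} (hf : ∀ i, Measurable fun ω => f ω i) :
    Measurable f :=
  measurable_pi_lambda f hf

/-! ### The process `Y` has the Ornstein-Uhlenbeck transitions -/

section Markov

variable {N : ℕ} {Ω : Type*} [MeasurableSpace Ω] {P : Measure Ω} {α : Fin N → ℝ}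
  {W : (Fin N → ℝ) → Ω → ℝ}

theorem ofMultiparameter_Icc {Ω : Type*} (Y : (Fin N → ℝ≥0) → Ω → ℝ) (t : Fin N → ℝ≥0) :
    ofMultiparameter Y (Set.Icc 0 t) = Y t :=
  Icc_zero_injective.extend_apply Y 0 t

theorem isWienerIntegral_ouIntegrand (hW : IsBrownianSheet P W) (hα : ∀ i, 0 < α i)
    (t : Fin N → ℝ≥0) :
    IsWienerIntegral P W (ouIntegrand α t) (wienerIntegral P W (ouIntegrand α t)) :=
  isWienerIntegral_wienerIntegral hW (memLp_ouIntegrand hα t)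

theorem wienerIntegral_ouIntegrand_zero (hW : IsBrownianSheet P W) (hα : ∀ i, 0 < α i) :
    wienerIntegral P W (ouIntegrand α 0) =ᵐ[P] 0 := by
  have hI := isWienerIntegral_ouIntegrand hW hα 0
  have hmap := hI.map_eq hW
  simp_rw [sq, integral_ouIntegrand_mul hα] at hmap
  have h0 : ∀ᵐ x ∂(P.map (wienerIntegral P W (ouIntegrand α 0))), x = 0 := by
    rw [hmap]
    simp
  exact ae_of_ae_map hI.2.1.aemeasurable h0

/-- The integrand of the increment of the Wiener integral over `[0,t] \ ⋃ B`. -/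
noncomputable def incrementIntegrand (α : Fin N → ℝ) (t : Fin N → ℝ≥0)
    (B : Finset (Set (Fin N → ℝ≥0))) (u : Fin N → ℝ) : ℝ :=
  ouIntegrand α t u + ∑ S ∈ subfamilies B, -(-1 : ℝ) ^ (S.card + 1) *
    ouIntegrand α (corner (⋂₀ (S : Set (Set (Fin N → ℝ≥0))))) u

/-- The increment of the Wiener integral over `[0,t] \ ⋃ B`. -/
noncomputable def increment (P : Measure Ω) (W : (Fin N → ℝ) → Ω → ℝ) (α : Fin N → ℝ)
    (t : Fin N → ℝ≥0) (B : Finset (Set (Fin N → ℝ≥0))) (ω : Ω) : ℝ :=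
  wienerIntegral P W (ouIntegrand α t) ω + ∑ S ∈ subfamilies B, -(-1 : ℝ) ^ (S.card + 1) *
    wienerIntegral P W (ouIntegrand α (corner (⋂₀ (S : Set (Set (Fin N → ℝ≥0)))))) ω

theorem isWienerIntegral_increment (hW : IsBrownianSheet P W) (hα : ∀ i, 0 < α i)
    (t : Fin N → ℝ≥0) (B : Finset (Set (Fin N → ℝ≥0))) :
    IsWienerIntegral P W (incrementIntegrand α t B) (increment P W α t B) :=
  (isWienerIntegral_ouIntegrand hW hα t).add hW (IsWienerIntegral.sum_mul hW _ _ fun _ =>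
    isWienerIntegral_ouIntegrand hW hα _)

theorem covariance_increment_left (hW : IsBrownianSheet P W) (hα : ∀ i, 0 < α i)
    (t : Fin N → ℝ≥0) (B : Finset (Set (Fin N → ℝ≥0))) {Z : Ω → ℝ} (hZ : MemLp Z 2 P) :
    covariance (increment P W α t B) Z P =
      covariance (wienerIntegral P W (ouIntegrand α t)) Z P -
        ∑ S ∈ subfamilies B, (-1 : ℝ) ^ (S.card + 1) * covariance (wienerIntegral P W
          (ouIntegrand α (corner (⋂₀ (S : Set (Set (Fin N → ℝ≥0))))))) Z P := by
  have := hW.gaussian.isProbabilityMeasure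
  have hI : ∀ u, MemLp (wienerIntegral P W (ouIntegrand α u)) 2 P := fun u =>
    (isWienerIntegral_ouIntegrand hW hα u).2.1
  have e : increment P W α t B = wienerIntegral P W (ouIntegrand α t) + fun ω =>
    ∑ S ∈ subfamilies B, -(-1 : ℝ) ^ (S.card + 1) *
      wienerIntegral P W (ouIntegrand α (corner (⋂₀ (S : Set (Set (Fin N → ℝ≥0)))))) ω := rfl
  rw [e, covariance_add_left (hI t) (memLp_finsetSum _ fun S _ => (hI _).const_mul _) hZ,
    covariance_fun_sum_left' (fun S _ => (hI _).const_mul _) hZ]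
  simp_rw [covariance_const_mul_left, neg_mul, Finset.sum_neg_distrib, ← sub_eq_add_neg]

theorem covariance_increment_wienerIntegral (hW : IsBrownianSheet P W) (hα : ∀ i, 0 < α i)
    {t : Fin N → ℝ≥0} {B : Finset (Set (Fin N → ℝ≥0))}
    (hB : IsExtremalIn (rectangles N) (Set.Icc 0 t) B) (u : Fin N → ℝ≥0) :
    covariance (increment P W α t B) (wienerIntegral P W (ouIntegrand α u)) P =
      (Real.exp (2 * ∑ i, α i * ((u ⊓ t) i : ℝ)) -
        ∑ S ∈ subfamilies B, (-1 : ℝ) ^ (S.card + 1) * Real.exp (2 * ∑ i, α i *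
          ((u ⊓ corner (⋂₀ (S : Set (Set (Fin N → ℝ≥0))))) i : ℝ))) / ∏ i, (2 * α i) := by
  have hI := isWienerIntegral_ouIntegrand hW hα
  rw [covariance_increment_left hW hα t B (hI u).2.1]
  simp_rw [(hI _).covariance_eq hW (hI u), integral_ouIntegrand_mul hα, inf_comm _ u]
  -- The constants `-1` in the kernel cancel because the signs add up to `1`.
  have h1 := sum_subfamilies_sign hB
  simp_rw [mul_div_assoc', ← Finset.sum_div, mul_sub, mul_one, Finset.sum_sub_distrib, h1]
  ring

/-- This orthogonality is the core of the Markov property: the increment is uncorrelated with each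
integral over a rectangle that misses `[0,t] \ ⋃ B`. -/
theorem covariance_increment_wienerIntegral_eq_zero (hW : IsBrownianSheet P W)
    (hα : ∀ i, 0 < α i) {t : Fin N → ℝ≥0} {B : Finset (Set (Fin N → ℝ≥0))}
    (hB : IsExtremalIn (rectangles N) (Set.Icc 0 t) B) {u b : Fin N → ℝ≥0}
    (hb : Set.Icc 0 b ∈ B) (hub : u ⊓ t ≤ b) :
    covariance (increment P W α t B) (wienerIntegral P W (ouIntegrand α u)) P = 0 := by
  rw [covariance_increment_wienerIntegral hW hα hB,
    sum_subfamilies_inf hB hb hub fun x => Real.exp (2 * ∑ i, α i * (x i : ℝ)), sub_self,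
    zero_div]

theorem corner_sInter_le_of_isExtremalIn {t : Fin N → ℝ≥0} {B : Finset (Set (Fin N → ℝ≥0))}
    (hB : IsExtremalIn (rectangles N) (Set.Icc 0 t) B) {S : Finset (Set (Fin N → ℝ≥0))}
    (hS : S ∈ subfamilies B) :
    ∃ b, Set.Icc 0 b ∈ B ∧ corner (⋂₀ (S : Set (Set (Fin N → ℝ≥0)))) ≤ b ∧ b ≤ t := by
  obtain ⟨hSB, V, hV⟩ := mem_subfamilies.1 hS
  obtain ⟨b, rfl⟩ := hB.mem V (hSB hV)
  exact ⟨b, hSB hV, corner_sInter_le hB.mem hS hV,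
    Icc_zero_subset_iff.1 ((Set.subset_sUnion_of_mem (hSB hV)).trans hB.subset)⟩

/-- All subtracted integrals are orthogonal to the increment `D`, so `Var D = Cov(I_t, D)`, which is
a single alternating sum instead of a double one. -/
theorem variance_increment (hW : IsBrownianSheet P W) (hα : ∀ i, 0 < α i)
    {t : Fin N → ℝ≥0} {B : Finset (Set (Fin N → ℝ≥0))}
    (hB : IsExtremalIn (rectangles N) (Set.Icc 0 t) B) :
    variance (increment P W α t B) P = (Real.exp (2 * ∑ i, α i * (t i : ℝ)) -
        ∑ S ∈ subfamilies B, (-1 : ℝ) ^ (S.card + 1) * Real.exp (2 * ∑ i, α i *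
          (corner (⋂₀ (S : Set (Set (Fin N → ℝ≥0)))) i : ℝ))) / ∏ i, (2 * α i) := by
  have hD := (isWienerIntegral_increment hW hα t B).2.1
  rw [← covariance_self hD.aemeasurable, covariance_increment_left hW hα t B hD,
    covariance_comm, covariance_increment_wienerIntegral hW hα hB t, inf_idem]
  have h0 : ∑ S ∈ subfamilies B, (-1 : ℝ) ^ (S.card + 1) * covariance (wienerIntegral P W
      (ouIntegrand α (corner (⋂₀ (S : Set (Set (Fin N → ℝ≥0))))))) (increment P W α t B) P = 0 := by
    refine Finset.sum_eq_zero fun S hS => ?_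
    obtain ⟨b, hb, hSb, -⟩ := corner_sInter_le_of_isExtremalIn hB hS
    rw [covariance_comm, covariance_increment_wienerIntegral_eq_zero hW hα hB hb
      (inf_le_left.trans hSb), mul_zero]
  rw [h0, sub_zero]
  congr 2
  refine Finset.sum_congr rfl fun S hS => ?_
  obtain ⟨b, -, hSb, hbt⟩ := corner_sInter_le_of_isExtremalIn hB hS
  rw [inf_eq_right.2 (hSb.trans hbt)]

variable {σ : ℝ} {Y₀ : Ω → ℝ} {Y : (Fin N → ℝ≥0) → Ω → ℝ}

/-- The increment is independent of the process on the strong past. -/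
theorem indepFun_increment [IsProbabilityMeasure P] (hW : IsBrownianSheet P W) (hα : ∀ i, 0 < α i)
    (hY₀ : Measurable Y₀) (hind : IndepFun Y₀ (fun ω t => W t ω) P)
    (hY : ∀ t, Y t =ᵐ[P] fun ω => Real.exp (-∑ i, α i * (t i : ℝ)) *
      (Y₀ ω + σ * wienerIntegral P W (ouIntegrand α t) ω))
    {t : Fin N → ℝ≥0} {B : Finset (Set (Fin N → ℝ≥0))}
    (hB : IsExtremalIn (rectangles N) (Set.Icc 0 t) B) (c : ℝ) {ξ : Ω → ℝ}
    (hξ : ξ =ᵐ[P] fun ω => c * increment P W α t B ω) :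
    IndepFun ξ (fun ω (u : {u : Fin N → ℝ≥0 // ∃ b, Set.Icc 0 b ∈ B ∧ u ⊓ t ≤ b}) => Y u ω) P := by
  set Q := {u : Fin N → ℝ≥0 // ∃ b, Set.Icc 0 b ∈ B ∧ u ⊓ t ≤ b}
  have hI := isWienerIntegral_ouIntegrand hW hα
  have hD := isWienerIntegral_increment hW hα t B
  have hWm : MeasurableSpace.comap (fun ω t => W t ω) inferInstance ≤ ‹MeasurableSpace Ω› :=
    (measurable_pi_lambda _ hW.measurable).comap_le
  choose J hJm hIJ using fun u => (hI u).exists_measurable_comap hW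
  obtain ⟨D, hDm, hDD⟩ := hD.exists_measurable_comap hW
  have hgauss : IsGaussianProcess (Sum.elim (fun _ : Unit => increment P W α t B)
      fun u : Q => wienerIntegral P W (ouIntegrand α u.1)) P := by
    refine isGaussianProcess_of_isWienerIntegral hW
      (f := Sum.elim (fun _ : Unit => incrementIntegrand α t B) fun u : Q => ouIntegrand α u.1) ?_
    rintro (_ | u)
    · exact hD
    · exact hI u.1
  have h1 := hgauss.indepFun_of_covariance_eq_zero (fun _ => hD.2.1.aemeasurable)
    (fun u => (hI u.1).2.1.aemeasurable) fun _ u => by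
      obtain ⟨b, hb, hub⟩ := u.2
      exact covariance_increment_wienerIntegral_eq_zero hW hα hB hb hub
  -- From here on the `σ(W)`-measurable versions `D` and `J` replace the integrals; `ξ` and `Y`
  -- return at the end through almost sure equality.
  have h2 : IndepFun (fun ω (_ : Unit) => D ω) (fun ω (u : Q) => J u.1 ω) P :=
    h1.process_congr (fun _ => hDD) fun u => hIJ u.1
  have hDJ : Measurable[MeasurableSpace.comap (fun ω t => W t ω) inferInstance]
      fun ω => ((fun _ : Unit => D ω), fun u : Q => J u.1 ω) :=
    Measurable.prodMk (m := MeasurableSpace.comap (fun ω t => W t ω) inferInstance)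
      (measurable_pi_of_forall fun _ => hDm) (measurable_pi_of_forall fun u => hJm u.1)
  have h3 : IndepFun Y₀ (fun ω => ((fun _ : Unit => D ω), fun u : Q => J u.1 ω)) P :=
    (IndepFun_iff_Indep _ _ _).2 (indep_of_indep_of_le_right ((IndepFun_iff_Indep _ _ _).1 hind)
      hDJ.comap_le)
  have h4 := IndepFun.prodMk_of_indepFun_prodMk
    (measurable_pi_lambda _ fun _ => hDm.mono hWm le_rfl) hY₀
    (measurable_pi_lambda _ fun u : Q => (hJm u.1).mono hWm le_rfl) h2 h3
  have h5 : IndepFun (fun ω (_ : Unit) => c * D ω) (fun ω (u : Q) =>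
      Real.exp (-∑ i, α i * (u.1 i : ℝ)) * (Y₀ ω + σ * J u.1 ω)) P :=
    h4.comp (φ := fun (x : Unit → ℝ) (_ : Unit) => c * x ())
      (ψ := fun (p : ℝ × (Q → ℝ)) (u : Q) => Real.exp (-∑ i, α i * (u.1 i : ℝ)) * (p.1 + σ * p.2 u))
      (by fun_prop) (by fun_prop)
  have h6 : IndepFun (fun ω (_ : Unit) => ξ ω) (fun ω (u : Q) => Y u.1 ω) P :=
    h5.process_congr
      (fun _ => by filter_upwards [hξ, hDD] with ω h h'; rw [h, h'])
      fun u => by filter_upwards [hY u.1, hIJ u.1] with ω h h'; rw [h, h']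
  exact h6.comp (φ := fun x : Unit → ℝ => x ()) (ψ := id) (measurable_pi_apply ()) measurable_id

/-- The weights `e^{m(U)}` undo the exponential decay of each `Y`, leaving `Y₀ + σ I`. As the signs
add up to `1`, `Y₀` cancels and only the increment remains. -/
theorem residual_ae_eq (hN : 1 ≤ N) (hα : ∀ i, 0 < α i)
    (hY : ∀ t, Y t =ᵐ[P] fun ω => Real.exp (-∑ i, α i * (t i : ℝ)) *
      (Y₀ ω + σ * wienerIntegral P W (ouIntegrand α t) ω))
    {t : Fin N → ℝ≥0} {B : Finset (Set (Fin N → ℝ≥0))}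
    (hB : IsExtremalIn (rectangles N) (Set.Icc 0 t) B) :
    (fun ω => ofMultiparameter Y (Set.Icc 0 t) ω - transitionMean (axisMeasureNonneg α) 1
      (Set.Icc 0 t) B (borderVector (ofMultiparameter Y) B ω)) =ᵐ[P]
      fun ω => (Real.exp (-∑ i, α i * (t i : ℝ)) * σ) * increment P W α t B ω := by
  have hall : ∀ᵐ ω ∂P, ∀ S : subfamilies B,
      Y (corner (⋂₀ (S.1 : Set (Set (Fin N → ℝ≥0))))) ω = _ :=
    ae_all_iff.2 fun S => hY (corner (⋂₀ (S.1 : Set (Set (Fin N → ℝ≥0)))))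
  filter_upwards [hY t, hall] with ω h1 h2
  rw [transitionMean_rectangles hN hα t hB.mem, ofMultiparameter_Icc, h1]
  have h3 : ∑ S ∈ subfamilies B, (-1 : ℝ) ^ (S.card + 1) *
      (ofMultiparameter Y (Set.Icc 0 (corner (⋂₀ (S : Set (Set (Fin N → ℝ≥0)))))) ω *
        Real.exp (∑ i, α i * (corner (⋂₀ (S : Set (Set (Fin N → ℝ≥0)))) i : ℝ)))
      = ∑ S ∈ subfamilies B, ((-1 : ℝ) ^ (S.card + 1) * Y₀ ω + σ * ((-1 : ℝ) ^ (S.card + 1) *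
        wienerIntegral P W (ouIntegrand α (corner (⋂₀ (S : Set (Set (Fin N → ℝ≥0)))))) ω)) := by
    refine Finset.sum_congr rfl fun S hS => ?_
    rw [ofMultiparameter_Icc, h2 ⟨S, hS⟩, mul_right_comm, ← Real.exp_add, neg_add_cancel,
      Real.exp_zero]
    ring
  rw [h3, Finset.sum_add_distrib, ← Finset.sum_mul, sum_subfamilies_sign hB, ← Finset.mul_sum,
    increment]
  simp only [neg_mul, Finset.sum_neg_distrib]
  ring

theorem map_residual (hN : 1 ≤ N) (hW : IsBrownianSheet P W) (hα : ∀ i, 0 < α i)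
    {t : Fin N → ℝ≥0} {B : Finset (Set (Fin N → ℝ≥0))}
    (hB : IsExtremalIn (rectangles N) (Set.Icc 0 t) B) {ξ : Ω → ℝ}
    (hξ : ξ =ᵐ[P] fun ω => (Real.exp (-∑ i, α i * (t i : ℝ)) * σ) * increment P W α t B ω) :
    P.map ξ = gaussianReal 0 (transitionVariance (axisMeasureNonneg α) 1
      (√(2 * σ ^ 2 / ∏ i, (2 * α i))) (Set.Icc 0 t) B).toNNReal := by
  have hD := (isWienerIntegral_increment hW hα t B).const_mul
    (Real.exp (-∑ i, α i * (t i : ℝ)) * σ)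
  rw [Measure.map_congr hξ, hD.map_eq hW, ← hD.variance_eq hW, variance_const_mul,
    variance_increment hW hα hB, transitionVariance_rectangles hN hα t hB.mem]
  congr 2
  have h1 : Real.exp (-∑ i, α i * (t i : ℝ)) ^ 2 = Real.exp (-2 * ∑ i, α i * (t i : ℝ)) := by
    rw [← Real.exp_nat_mul]
    congr 1
    push_cast
    ring
  have h2 : Real.exp (-2 * ∑ i, α i * (t i : ℝ)) * Real.exp (2 * ∑ i, α i * (t i : ℝ)) = 1 := by
    rw [← Real.exp_add, ← add_mul]
    simp
  rw [mul_pow, h1, ← h2]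
  ring

/-- The transition of the process `Y`, given any `σ`-field between the one of the border vector
and the strong past. -/
theorem condLExp_ofMultiparameter {Ω : Type*} {m m₀ : MeasurableSpace Ω} {P : Measure Ω}
    [IsProbabilityMeasure P] {W : (Fin N → ℝ) → Ω → ℝ} {Y₀ : Ω → ℝ} {Y : (Fin N → ℝ≥0) → Ω → ℝ}
    (hN : 1 ≤ N) (hW : IsBrownianSheet P W) (hα : ∀ i, 0 < α i)
    (hY₀ : Measurable Y₀) (hind : IndepFun Y₀ (fun ω t => W t ω) P)
    (hYmeas : ∀ t, Measurable (Y t))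
    (hY : ∀ t, Y t =ᵐ[P] fun ω => Real.exp (-∑ i, α i * (t i : ℝ)) *
      (Y₀ ω + σ * wienerIntegral P W (ouIntegrand α t) ω))
    {t : Fin N → ℝ≥0} {B : Finset (Set (Fin N → ℝ≥0))}
    (hB : IsExtremalIn (rectangles N) (Set.Icc 0 t) B)
    (hbm : MeasurableSpace.comap (borderVector (ofMultiparameter Y) B) inferInstance ≤ m)
    (hm : m ≤ strongPast (rectangles N) (ofMultiparameter Y)
      (Set.Icc 0 t \ ⋃₀ (B : Set (Set (Fin N → ℝ≥0))))) {f : ℝ → ℝ≥0∞} (hf : Measurable f) :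
    condLExp m P (fun ω => f (ofMultiparameter Y (Set.Icc 0 t) ω)) =ᵐ[P] fun ω =>
      ∫⁻ y, f y ∂(transition (axisMeasureNonneg α) 1 (√(2 * σ ^ 2 / ∏ i, (2 * α i)))
        (Set.Icc 0 t) B (borderVector (ofMultiparameter Y) B ω)) := by
  have hmeas : ∀ u, Measurable (ofMultiparameter Y (Set.Icc 0 u)) := fun u => by
    rw [ofMultiparameter_Icc]
    exact hYmeas u
  have hres := residual_ae_eq hN hα hY hB
  have hm₀ : m ≤ m₀ := hm.trans (strongPast_le (by
    rintro _ ⟨u, rfl⟩ -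
    exact (hmeas u).comap_le))
  refine condLExp_eq_lintegral_gaussianReal hm₀ (hmeas t)
    ((measurable_transitionMean _ _ _ _).comp (Measurable.of_comap_le hbm))
    (map_residual hN hW hα hB hres) ?_ hf
  have hind' := indepFun_increment hW hα hY₀ hind hY hB _ hres
  refine indep_of_indep_of_le_left ((IndepFun_iff_Indep _ _ _).1 hind').symm
    (hm.trans (strongPast_le ?_))
  rintro _ ⟨u, rfl⟩ hu
  -- The point `u ⊓ t` lies in both `[0,u]` and `[0,t]`; if these rectangles meet only inside `⋃ B`,
  -- it lies in some `[0,b] ∈ B`.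
  have huQ : ∃ b, Set.Icc 0 b ∈ B ∧ u ⊓ t ≤ b := by
    by_contra hcon
    push Not at hcon
    have : u ⊓ t ∈ Set.Icc 0 u ∩ (Set.Icc 0 t \ ⋃₀ (B : Set (Set (Fin N → ℝ≥0)))) := by
      refine ⟨⟨zero_le, inf_le_left⟩, ⟨zero_le, inf_le_right⟩, ?_⟩
      rintro ⟨V, hV, huV⟩
      obtain ⟨b, rfl⟩ := hB.mem V hV
      exact hcon b hV huV.2
    rw [hu] at this
    exact this
  simp only
  rw [ofMultiparameter_Icc]
  have hpi := comap_measurable (m := MeasurableSpace.pi)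
    (fun ω (u : {u : Fin N → ℝ≥0 // ∃ b, Set.Icc 0 b ∈ B ∧ u ⊓ t ≤ b}) => Y u ω)
  exact ((measurable_pi_apply (⟨u, huQ⟩ :
    {u : Fin N → ℝ≥0 // ∃ b, Set.Icc 0 b ∈ B ∧ u ⊓ t ≤ b})).comp hpi).comap_le

theorem comap_borderVector_le_strongPast {Ω : Type*} (X : Set (Fin N → ℝ≥0) → Ω → ℝ)
    {A : Set (Fin N → ℝ≥0)} {B : Finset (Set (Fin N → ℝ≥0))}
    (hB : IsExtremalIn (rectangles N) A B) :
    MeasurableSpace.comap (borderVector X B) inferInstance ≤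
      strongPast (rectangles N) X (A \ ⋃₀ (B : Set (Set (Fin N → ℝ≥0)))) := by
  refine Measurable.comap_le (measurable_pi_of_forall fun U => ?_)
  obtain ⟨S, hSB, hSn, hU⟩ := exists_subset_of_mem_borderSets U.2
  obtain ⟨s, hs⟩ := exists_sInter_eq_Icc hSn fun V hV => hB.mem V (hSB hV)
  obtain ⟨V, hV⟩ := hSn
  refine Measurable.of_comap_le (comap_le_strongPast (V := V) ⟨s, (hU.trans hs).symm⟩
    (hB.mem V (hSB hV)) ?_ ?_)
  · rw [hU]
    exact Set.sInter_subset_of_mem hV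
  · exact Set.disjoint_iff_inter_eq_empty.1
      (Set.disjoint_sdiff_right.mono_left (Set.subset_sUnion_of_mem (hSB hV)))

/-- The process `Y` is a set-indexed Ornstein-Uhlenbeck process. -/
theorem isSIOU_ofMultiparameter [IsProbabilityMeasure P] (hN : 1 ≤ N)
    (hW : IsBrownianSheet P W) (hα : ∀ i, 0 < α i)
    (hσ : 0 < σ) (hY₀ : Measurable Y₀) (hind : IndepFun Y₀ (fun ω t => W t ω) P)
    (hYmeas : ∀ t, Measurable (Y t))
    (hY : ∀ t, Y t =ᵐ[P] fun ω => Real.exp (-∑ i, α i * (t i : ℝ)) *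
      (Y₀ ω + σ * wienerIntegral P W (ouIntegrand α t) ω)) :
    IsSIOU P (rectangles N) (axisMeasureNonneg α) 1 (√(2 * σ ^ 2 / ∏ i, (2 * α i)))
      (P.map Y₀) (ofMultiparameter Y) := by
  have hprod : 0 < ∏ i, (2 * α i) := Finset.prod_pos fun i _ => mul_pos two_pos (hα i)
  refine ⟨one_pos, Real.sqrt_pos.2 (by positivity), ?_, ?_, ?_, ?_⟩
  · rintro _ ⟨t, rfl⟩
    simp only
    rw [ofMultiparameter_Icc]
    exact hYmeas t
  · rw [sInter_rectangles, ofMultiparameter_Icc]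
    refine Measure.map_congr ?_
    filter_upwards [hY 0, wienerIntegral_ouIntegrand_zero hW hα] with ω h h'
    rw [h, h']
    simp
  · rintro _ ⟨t, rfl⟩ B hB f hf
    have hle := comap_borderVector_le_strongPast (ofMultiparameter Y) hB
    -- The two extreme choices of the conditioning `σ`-field give the same kernel.
    exact (condLExp_ofMultiparameter hN hW hα hY₀ hind hYmeas hY hB hle le_rfl hf).trans
      (condLExp_ofMultiparameter hN hW hα hY₀ hind hYmeas hY hB le_rfl hle hf).symm
  · rintro _ ⟨t, rfl⟩ B hB f hf
    exact condLExp_ofMultiparameter hN hW hα hY₀ hind hYmeas hY hB le_rfl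
      (comap_borderVector_le_strongPast (ofMultiparameter Y) hB) hf

end Markov

/-! ### The transitions determine the law -/

section Uniqueness

variable {N : ℕ}

open Classical in
/-- The path `t ↦ X_{[0,t]}`, restricted to a finite set of times and set to `0` elsewhere. -/
noncomputable def maskedPath {Ω : Type*} (F : Finset (Fin N → ℝ≥0))
    (X : Set (Fin N → ℝ≥0) → Ω → ℝ) (ω : Ω) (t : Fin N → ℝ≥0) : ℝ :=
  if t ∈ F then X (Set.Icc 0 t) ω else 0

theorem maskedPath_of_mem {Ω : Type*} {F : Finset (Fin N → ℝ≥0)}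
    {X : Set (Fin N → ℝ≥0) → Ω → ℝ} {t : Fin N → ℝ≥0} (ht : t ∈ F) (ω : Ω) :
    maskedPath F X ω t = X (Set.Icc 0 t) ω := if_pos ht

theorem measurable_maskedPath {Ω : Type*} {m : MeasurableSpace Ω} {F : Finset (Fin N → ℝ≥0)}
    {X : Set (Fin N → ℝ≥0) → Ω → ℝ} (hX : ∀ t ∈ F, Measurable (X (Set.Icc 0 t))) :
    Measurable (maskedPath F X) := by
  refine measurable_pi_of_forall fun t => ?_
  by_cases ht : t ∈ F
  · simpa only [maskedPath, ht, if_true] using hX t ht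
  · simp only [maskedPath, ht, if_false]
    exact measurable_const

theorem maskedPath_empty {Ω : Type*} (X : Set (Fin N → ℝ≥0) → Ω → ℝ) (ω : Ω) :
    maskedPath ∅ X ω = fun _ => 0 :=
  funext fun t => if_neg (Finset.notMem_empty t)

theorem maskedPath_eq_update {Ω : Type*} [DecidableEq (Fin N → ℝ≥0)]
    (X : Set (Fin N → ℝ≥0) → Ω → ℝ) {F : Finset (Fin N → ℝ≥0)} {a : Fin N → ℝ≥0} (ha : a ∈ F) :
    maskedPath F X = (fun q : ((Fin N → ℝ≥0) → ℝ) × ℝ => Function.update q.1 a q.2) ∘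
      fun ω => (maskedPath (F.erase a) X ω, X (Set.Icc 0 a) ω) := by
  funext ω t
  rcases eq_or_ne t a with rfl | hta
  · simp [maskedPath, ha]
  · simp [maskedPath, hta]

open Classical in
/-- The maximal elements of the family `[0,s] ∩ [0,a]`, `s ∈ F`. -/
noncomputable def maximalTraces (F : Finset (Fin N → ℝ≥0)) (a : Fin N → ℝ≥0) :
    Finset (Set (Fin N → ℝ≥0)) :=
  (F.image fun s => Set.Icc 0 (s ⊓ a)).filter
    fun U => Maximal (· ∈ F.image fun s => Set.Icc 0 (s ⊓ a)) U

theorem mem_maximalTraces {F : Finset (Fin N → ℝ≥0)} {a : Fin N → ℝ≥0}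
    {U : Set (Fin N → ℝ≥0)} (hU : U ∈ maximalTraces F a) :
    ∃ s ∈ F, U = Set.Icc 0 (s ⊓ a) := by
  classical
  obtain ⟨s, hs, rfl⟩ := Finset.mem_image.1 (Finset.mem_filter.1 hU).1
  exact ⟨s, hs, rfl⟩

theorem exists_subset_maximalTraces {F : Finset (Fin N → ℝ≥0)} {a s : Fin N → ℝ≥0}
    (hs : s ∈ F) : ∃ U ∈ maximalTraces F a, Set.Icc 0 (s ⊓ a) ⊆ U := by
  classical
  obtain ⟨U, hsU, hU⟩ := Finset.exists_le_maximal (F.image fun s => Set.Icc 0 (s ⊓ a))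
    (Finset.mem_image_of_mem _ hs)
  exact ⟨U, Finset.mem_filter.2 ⟨hU.prop, hU⟩, hsU⟩

theorem isExtremalIn_maximalTraces {F : Finset (Fin N → ℝ≥0)} (hF : F.Nonempty)
    (a : Fin N → ℝ≥0) : IsExtremalIn (rectangles N) (Set.Icc 0 a) (maximalTraces F a) where
  nonempty := by
    obtain ⟨s, hs⟩ := hF
    obtain ⟨U, hU, -⟩ := exists_subset_maximalTraces (a := a) hs
    exact ⟨U, hU⟩
  mem := fun U hU => by
    obtain ⟨s, -, rfl⟩ := mem_maximalTraces hU
    exact ⟨_, rfl⟩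
  antichain := fun U hU V hV hUV => by
    classical
    exact ((Finset.mem_filter.1 hU).2).eq_of_le (Finset.mem_filter.1 hV).1 hUV
  subset := by
    refine Set.sUnion_subset fun U hU => ?_
    obtain ⟨s, -, rfl⟩ := mem_maximalTraces hU
    exact Icc_zero_subset_iff.2 inf_le_right

/-- The traces of `F` cover `[0,s] ∩ [0,a]`, so every value at a time of `F` is measurable for the
strong past of the increment at `a`. -/
theorem Icc_inter_sdiff_maximalTraces {F : Finset (Fin N → ℝ≥0)} {a s : Fin N → ℝ≥0}
    (hs : s ∈ F) :
    Set.Icc 0 s ∩ (Set.Icc 0 a \ ⋃₀ (maximalTraces F a : Set (Set (Fin N → ℝ≥0)))) = ∅ := by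
  refine Set.eq_empty_of_forall_notMem fun x hx => hx.2.2 ?_
  obtain ⟨U, hU, hsU⟩ := exists_subset_maximalTraces (a := a) hs
  exact ⟨U, hU, hsU ⟨zero_le, le_inf hx.1.2 hx.2.1.2⟩⟩

theorem inf_mem_of_maximal {F : Finset (Fin N → ℝ≥0)} [DecidableEq (Fin N → ℝ≥0)]
    (hF : InfClosed (F : Set (Fin N → ℝ≥0))) {a : Fin N → ℝ≥0} (ha : Maximal (· ∈ F) a)
    {s t : Fin N → ℝ≥0} (hs : s ∈ F.erase a) (ht : t ∈ F) : s ⊓ t ∈ F.erase a := by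
  refine Finset.mem_erase.2 ⟨fun h => ?_, hF (Finset.mem_of_mem_erase hs) ht⟩
  have has : a ≤ s := h ▸ inf_le_left
  exact Finset.ne_of_mem_erase hs (le_antisymm (ha.2 (Finset.mem_of_mem_erase hs) has) has)

/-- The border vector of the last increment, read off a path. -/
noncomputable def borderOfPath (B : Finset (Set (Fin N → ℝ≥0))) (p : (Fin N → ℝ≥0) → ℝ) :
    {U // U ∈ borderSets B} → ℝ :=
  fun U => p (corner U.1)

theorem measurable_borderOfPath (B : Finset (Set (Fin N → ℝ≥0))) :
    Measurable (borderOfPath B) :=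
  measurable_pi_lambda _ fun _ => measurable_pi_apply _

/-- Inf-closedness and maximality of `a` keep all corners of the border vector among the remaining
times. The transition at `a` is thus a function of the remaining path, the same for any two
processes. -/
theorem borderVector_eq_borderOfPath {Ω : Type*} (X : Set (Fin N → ℝ≥0) → Ω → ℝ)
    {F : Finset (Fin N → ℝ≥0)} [DecidableEq (Fin N → ℝ≥0)]
    (hF : InfClosed (F : Set (Fin N → ℝ≥0))) {a : Fin N → ℝ≥0} (ha : Maximal (· ∈ F) a) (ω : Ω) :
    borderVector X (maximalTraces (F.erase a) a) ω =
      borderOfPath (maximalTraces (F.erase a) a) (maskedPath (F.erase a) X ω) := by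
  funext U
  obtain ⟨S, hSB, hSn, hU⟩ := exists_subset_of_mem_borderSets U.2
  obtain ⟨s, hsF, hs⟩ := exists_mem_sInter_eq_Icc (G := (F.erase a : Finset _))
    (fun x hx y hy => inf_mem_of_maximal hF ha hx (Finset.mem_of_mem_erase hy)) hSn fun V hV => by
      obtain ⟨s, hs, rfl⟩ := mem_maximalTraces (hSB hV)
      exact ⟨s ⊓ a, inf_mem_of_maximal hF ha hs ha.prop, rfl⟩
  rw [borderOfPath, hU.trans hs, corner_Icc, maskedPath_of_mem hsF, borderVector, hU.trans hs]

/-- The joint law of the remaining path and the value at `a` is disintegrated. The event `D` belongs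
to the strong past, so the conditional expectation may be integrated over it and replaced by the
transition. -/
theorem map_maskedPath_prod_apply {Ω : Type*} [MeasurableSpace Ω] {P : Measure Ω}
    [IsProbabilityMeasure P] {μ : Measure (Fin N → ℝ≥0)} {lam σ : ℝ} {ν : Measure ℝ}
    {X : Set (Fin N → ℝ≥0) → Ω → ℝ} (hX : IsSIOU P (rectangles N) μ lam σ ν X)
    {F : Finset (Fin N → ℝ≥0)} [DecidableEq (Fin N → ℝ≥0)]
    (hF : InfClosed (F : Set (Fin N → ℝ≥0))) {a : Fin N → ℝ≥0} (ha : Maximal (· ∈ F) a)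
    (hne : (F.erase a).Nonempty) {D : Set ((Fin N → ℝ≥0) → ℝ)} (hD : MeasurableSet D)
    {E : Set ℝ} (hE : MeasurableSet E) :
    P.map (fun ω => (maskedPath (F.erase a) X ω, X (Set.Icc 0 a) ω)) (D ×ˢ E) =
      ∫⁻ p in D, ∫⁻ y, E.indicator 1 y ∂(transition μ lam σ (Set.Icc 0 a)
        (maximalTraces (F.erase a) a) (borderOfPath (maximalTraces (F.erase a) a) p))
        ∂(P.map (maskedPath (F.erase a) X)) := by
  have hXm : ∀ t, Measurable (X (Set.Icc 0 t)) := fun t => hX.measurable _ ⟨t, rfl⟩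
  have hmask : Measurable (maskedPath (F.erase a) X) := measurable_maskedPath fun t _ => hXm t
  have hext := isExtremalIn_maximalTraces hne a
  have hpast : strongPast (rectangles N) X
      (Set.Icc 0 a \ ⋃₀ (maximalTraces (F.erase a) a : Set (Set (Fin N → ℝ≥0)))) ≤
      ‹MeasurableSpace Ω› := strongPast_le fun U hU _ => (hX.measurable U hU).comap_le
  have hmaskpast : Measurable[strongPast (rectangles N) X
      (Set.Icc 0 a \ ⋃₀ (maximalTraces (F.erase a) a : Set (Set (Fin N → ℝ≥0))))]
      (maskedPath (F.erase a) X) := measurable_maskedPath fun t ht =>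
    Measurable.of_comap_le (comap_le_strongPast ⟨t, rfl⟩ ⟨t, rfl⟩ subset_rfl
      (Icc_inter_sdiff_maximalTraces ht))
  have hind : Measurable (E.indicator (1 : ℝ → ℝ≥0∞)) := measurable_one.indicator hE
  have hcond := (hX.cMarkov _ ⟨a, rfl⟩ _ hext _ hind).trans (hX.cTransition _ ⟨a, rfl⟩ _ hext _ hind)
  have hker : Measurable fun p : (Fin N → ℝ≥0) → ℝ => ∫⁻ y, E.indicator 1 y ∂(transition μ lam σ
      (Set.Icc 0 a) (maximalTraces (F.erase a) a)
      (borderOfPath (maximalTraces (F.erase a) a) p)) :=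
    (measurable_lintegral_gaussianReal _ hind _).comp
      ((measurable_transitionMean _ _ _ _).comp (measurable_borderOfPath _))
  rw [Measure.map_apply (hmask.prodMk (hXm a)) (hD.prod hE),
    setLIntegral_map hD hker hmask]
  have h1 := setLIntegral_condLExp hpast P (fun ω => E.indicator 1 (X (Set.Icc 0 a) ω))
    (hmaskpast hD)
  have h2 : ∫⁻ ω in maskedPath (F.erase a) X ⁻¹' D, E.indicator 1 (X (Set.Icc 0 a) ω) ∂P
      = P ((fun ω => (maskedPath (F.erase a) X ω, X (Set.Icc 0 a) ω)) ⁻¹' D ×ˢ E) := by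
    have : (fun ω => E.indicator (1 : ℝ → ℝ≥0∞) (X (Set.Icc 0 a) ω))
        = (X (Set.Icc 0 a) ⁻¹' E).indicator 1 := rfl
    rw [this, lintegral_indicator_one (hXm a hE), Measure.restrict_apply (hXm a hE),
      Set.inter_comm]
    rfl
  rw [← h2, ← h1]
  refine lintegral_congr_ae (ae_restrict_of_ae ?_)
  filter_upwards [hcond] with ω hω
  rw [hω, borderVector_eq_borderOfPath X hF ha]

/-- Two set-indexed Ornstein-Uhlenbeck processes with the same parameters and initial law have
the same laws at finite inf-closed sets of times. -/
theorem map_maskedPath_eq {Ω Ω' : Type*} [MeasurableSpace Ω] [MeasurableSpace Ω']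
    {P : Measure Ω} {P' : Measure Ω'} [IsProbabilityMeasure P] [IsProbabilityMeasure P']
    {μ : Measure (Fin N → ℝ≥0)} {lam σ : ℝ} {ν : Measure ℝ}
    {X : Set (Fin N → ℝ≥0) → Ω → ℝ} {X' : Set (Fin N → ℝ≥0) → Ω' → ℝ}
    (hX : IsSIOU P (rectangles N) μ lam σ ν X) (hX' : IsSIOU P' (rectangles N) μ lam σ ν X')
    (F : Finset (Fin N → ℝ≥0)) (hF : InfClosed (F : Set (Fin N → ℝ≥0))) (h0 : 0 ∈ F) :
    P.map (maskedPath F X) = P'.map (maskedPath F X') := by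
  classical
  have hXm : ∀ t, Measurable (X (Set.Icc 0 t)) := fun t => hX.measurable _ ⟨t, rfl⟩
  have hXm' : ∀ t, Measurable (X' (Set.Icc 0 t)) := fun t => hX'.measurable _ ⟨t, rfl⟩
  induction F using Finset.strongInduction with
  | H F ih =>
  obtain ⟨a, ha⟩ := Finset.exists_maximal ⟨0, h0⟩
  have hupd : Measurable fun q : ((Fin N → ℝ≥0) → ℝ) × ℝ => Function.update q.1 a q.2 := by
    refine measurable_pi_lambda _ fun t => ?_
    rcases eq_or_ne t a with rfl | hta
    · simpa using measurable_snd
    · simpa [hta, Function.comp_def] using (measurable_pi_apply t).comp measurable_fst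
  have hm : Measurable (maskedPath (F.erase a) X) := measurable_maskedPath fun t _ => hXm t
  have hm' : Measurable (maskedPath (F.erase a) X') := measurable_maskedPath fun t _ => hXm' t
  rw [maskedPath_eq_update X ha.prop, maskedPath_eq_update X' ha.prop, ← Measure.map_map hupd (hm.prodMk (hXm a)),
    ← Measure.map_map hupd (hm'.prodMk (hXm' a))]
  congr 1
  have : IsProbabilityMeasure
      (P.map fun ω => (maskedPath (F.erase a) X ω, X (Set.Icc 0 a) ω)) :=
    Measure.isProbabilityMeasure_map (hm.prodMk (hXm a)).aemeasurable
  -- If `0` is maximal, then `F = {0}` and the initial law decides. Otherwise `0` remains after the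
  -- removal of `a`, so the extremal family is nonempty, as the transition requires.
  rcases eq_or_ne a 0 with rfl | ha0
  · have hempty : F.erase 0 = ∅ := by
      refine Finset.eq_empty_of_forall_notMem fun t ht => Finset.ne_of_mem_erase ht ?_
      exact le_antisymm (ha.2 (Finset.mem_of_mem_erase ht) zero_le) zero_le
    have hi : P.map (X (Set.Icc 0 0)) = P'.map (X' (Set.Icc 0 0)) := by
      rw [← sInter_rectangles, hX.initial, hX'.initial]
    have hpair : Measurable fun x : ℝ => ((fun _ => 0 : (Fin N → ℝ≥0) → ℝ), x) :=
      measurable_const.prodMk measurable_id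
    have := congrArg (Measure.map fun x : ℝ => ((fun _ => 0 : (Fin N → ℝ≥0) → ℝ), x)) hi
    rw [Measure.map_map hpair (hXm 0), Measure.map_map hpair (hXm' 0)] at this
    simpa only [hempty, maskedPath_empty, Function.comp_def] using this
  · have h0' : 0 ∈ F.erase a := Finset.mem_erase.2 ⟨ha0.symm, h0⟩
    have hF' : InfClosed ((F.erase a : Finset _) : Set (Fin N → ℝ≥0)) := fun x hx y hy =>
      inf_mem_of_maximal hF ha hx (Finset.mem_of_mem_erase hy)
    refine Measure.ext_prod fun {D E} hD hE => ?_
    rw [map_maskedPath_prod_apply hX hF ha ⟨0, h0'⟩ hD hE,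
      map_maskedPath_prod_apply hX' hF ha ⟨0, h0'⟩ hD hE,
      ih _ (Finset.erase_ssubset ha.prop) hF' h0']

/-- A finite set of times becomes inf-closed, still finite, after adding `0` and taking its
inf-closure. Its marginal is then a restriction of a law already identified, and finite-dimensional
laws determine the law on the product space. -/
theorem IsSIOU.map_eq {Ω Ω' : Type*} [MeasurableSpace Ω] [MeasurableSpace Ω']
    {P : Measure Ω} {P' : Measure Ω'} [IsProbabilityMeasure P] [IsProbabilityMeasure P']
    {μ : Measure (Fin N → ℝ≥0)} {lam σ : ℝ} {ν : Measure ℝ}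
    {X : Set (Fin N → ℝ≥0) → Ω → ℝ} {X' : Set (Fin N → ℝ≥0) → Ω' → ℝ}
    (hX : IsSIOU P (rectangles N) μ lam σ ν X) (hX' : IsSIOU P' (rectangles N) μ lam σ ν X') :
    P.map (fun ω (t : Fin N → ℝ≥0) => X (Set.Icc 0 t) ω) =
      P'.map (fun ω (t : Fin N → ℝ≥0) => X' (Set.Icc 0 t) ω) := by
  classical
  have hXm : ∀ t, Measurable (X (Set.Icc 0 t)) := fun t => hX.measurable _ ⟨t, rfl⟩
  have hXm' : ∀ t, Measurable (X' (Set.Icc 0 t)) := fun t => hX'.measurable _ ⟨t, rfl⟩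
  have hlim := isProjectiveLimit_map (P := P) (X := fun (t : Fin N → ℝ≥0) => X (Set.Icc 0 t))
    (measurable_pi_lambda _ hXm).aemeasurable
  have hlim' := isProjectiveLimit_map (P := P') (X := fun (t : Fin N → ℝ≥0) => X' (Set.Icc 0 t))
    (measurable_pi_lambda _ hXm').aemeasurable
  have hfam : ∀ I : Finset (Fin N → ℝ≥0),
      P.map (fun ω => I.restrict fun t => X (Set.Icc 0 t) ω) =
        P'.map (fun ω => I.restrict fun t => X' (Set.Icc 0 t) ω) := by
    intro I
    have hfin : (infClosure (insert 0 I : Finset (Fin N → ℝ≥0)) : Set (Fin N → ℝ≥0)).Finite :=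
      (Finset.finite_toSet _).infClosure
    have hsub : ((insert 0 I : Finset (Fin N → ℝ≥0)) : Set (Fin N → ℝ≥0)) ⊆
        (hfin.toFinset : Set (Fin N → ℝ≥0)) := by
      rw [hfin.coe_toFinset]
      exact subset_infClosure
    have hIF : ∀ t ∈ I, t ∈ hfin.toFinset := fun t ht => hsub (by simp [ht])
    have key := congrArg (Measure.map I.restrict) (map_maskedPath_eq hX hX' hfin.toFinset
      (by rw [hfin.coe_toFinset]; exact infClosed_infClosure) (hsub (by simp)))
    rw [Measure.map_map (Finset.measurable_restrict I) (measurable_maskedPath fun t _ => hXm t),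
      Measure.map_map (Finset.measurable_restrict I) (measurable_maskedPath fun t _ => hXm' t)]
      at key
    convert key using 2
    · funext ω t
      exact (maskedPath_of_mem (hIF t.1 t.2) ω).symm
    · funext ω t
      exact (maskedPath_of_mem (hIF t.1 t.2) ω).symm
  have hfin : ∀ I : Finset (Fin N → ℝ≥0),
      IsFiniteMeasure (P'.map fun ω => I.restrict fun t => X' (Set.Icc 0 t) ω) := fun I =>
    inferInstance
  refine IsProjectiveLimit.unique (P := fun I =>
    P'.map fun ω => I.restrict fun t => X' (Set.Icc 0 t) ω) ?_ hlim'
  intro I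
  exact (hlim I).trans (hfam I)

end Uniqueness

end SetIndexed

/-! ### The main theorem -/

theorem mainTheorem2 {N : ℕ} (hN : 1 ≤ N) {Ω : Type*} [MeasurableSpace Ω]
    (P : Measure Ω) [IsProbabilityMeasure P]
    (α : Fin N → ℝ) (hα : ∀ i, 0 < α i) (σ : ℝ) (hσ : 0 < σ)
    (W : (Fin N → ℝ) → Ω → ℝ) (hW : SetIndexed.IsBrownianSheet P W)
    (Y₀ : Ω → ℝ) (hY₀ : Measurable Y₀) (hind : IndepFun Y₀ (fun ω t => W t ω) P)
    (Y : (Fin N → ℝ≥0) → Ω → ℝ) (hYmeas : ∀ t, Measurable (Y t))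
    (hY : ∀ t, Y t =ᵐ[P] fun ω => Real.exp (-∑ i, α i * (t i : ℝ)) *
      (Y₀ ω + σ * SetIndexed.wienerIntegral P W (SetIndexed.ouIntegrand α t) ω)) :
    SetIndexed.IsIndexingCollection (SetIndexed.rectangles N) (SetIndexed.axisMeasureNonneg α) ∧
    SetIndexed.IsSIOU P (SetIndexed.rectangles N) (SetIndexed.axisMeasureNonneg α)
      1 (Real.sqrt (2 * σ ^ 2 / ∏ i, (2 * α i))) (P.map Y₀) (SetIndexed.ofMultiparameter Y) ∧
    ∀ {Ω' : Type*} [MeasurableSpace Ω'] (P' : Measure Ω') [IsProbabilityMeasure P']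
      (X : Set (Fin N → ℝ≥0) → Ω' → ℝ),
      SetIndexed.IsSIOU P' (SetIndexed.rectangles N) (SetIndexed.axisMeasureNonneg α)
        1 (Real.sqrt (2 * σ ^ 2 / ∏ i, (2 * α i))) (P.map Y₀) X →
      P'.map (fun ω (t : Fin N → ℝ≥0) => X (Set.Icc 0 t) ω) = P.map (fun ω t => Y t ω) := by
  have hSIOU := SetIndexed.isSIOU_ofMultiparameter hN hW hα hσ hY₀ hind hYmeas hY
  refine ⟨SetIndexed.isIndexingCollection_rectangles hα, hSIOU, fun P' _ X hX => ?_⟩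
  simpa only [SetIndexed.ofMultiparameter_Icc] using hX.map_eq hSIOU
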